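/- Theorem 3 (Local residue formula). A Farey interval is an interval $I=[c/d,a/b]\subset[0,1]$ with integers $b,d\ge 1$, $0\le c\le d$, $0\le a\le b$, $\gcd(a,b)=\gcd(c,d)=1$ and $ad-bc=1$. For a function $f:[0,1]\to\mathbb{R}$ put $$c_I(f)=f\Big(\frac{a+c}{b+d}\Big)-\frac{b}{b+d}\,f\Big(\frac ab\Big)-\frac{d}{b+d}\,f\Big(\frac cd\Big),\qquad T_I(f)=(b+d)\,c_I(f),\qquad Z_f(s)=\sum_I |T_I(f)|^s ,$$ the sum running over all Farey intervals. Let $f\in C^3([0,1])$ be real-valued, and suppose that for some $m>0$ one has $|f''(x)|\ge m$ for all $x\in[0,1]$. Then the series $Z_f(s)$ converges absolutely for $\Re(s)>2/3$, and for every $0<\eta<1/21$ the function $Z_f$ extends meromorphically from the half-plane $\Re(s)>2/3$ to its union with the disk $|s-\tfrac23|<\eta$; the extension has a simple pole at $s=\tfrac23$ and is holomorphic elsewhere, and $$\operatorname{Res}_{s=2/3} Z_f(s)=\frac{\sqrt3\,\Gamma(1/3)^3}{2^{2/3}\pi^3}\int_0^1|f''(v)|^{2/3}\,dv .$$ -/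

import Mathlib

open Set Filter Topology

noncomputable section

/-- A Farey interval `[c/d, a/b] ⊆ [0, 1]`: both fractions are reduced, with positive
denominators, and `a d - b c = 1`.  Reduced fractions are unique, so the quadruple
`(a, b, c, d)` and the interval determine each other. -/
structure FareyInterval where
  /-- numerator of the right endpoint -/
  a : ℤ
  /-- denominator of the right endpoint -/
  b : ℕ
  /-- numerator of the left endpoint -/
  c : ℤ
  /-- denominator of the left endpoint -/
  d : ℕ
  b_pos : 0 < b
  d_pos : 0 < d
  c_nonneg : 0 ≤ c
  c_le : c ≤ (d : ℤ)
  a_nonneg : 0 ≤ a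
  a_le : a ≤ (b : ℤ)
  gcd_ab : Int.gcd a (b : ℤ) = 1
  gcd_cd : Int.gcd c (d : ℤ) = 1
  det_eq : a * (d : ℤ) - (b : ℤ) * c = 1

/-- The Hata coefficient
`c_I(f) = f((a+c)/(b+d)) - b/(b+d) f(a/b) - d/(b+d) f(c/d)`. -/
def hataCoeff (f : ℝ → ℝ) (I : FareyInterval) : ℝ :=
  f (((I.a : ℝ) + (I.c : ℝ)) / ((I.b : ℝ) + (I.d : ℝ)))
    - (I.b : ℝ) / ((I.b : ℝ) + (I.d : ℝ)) * f ((I.a : ℝ) / (I.b : ℝ))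
    - (I.d : ℝ) / ((I.b : ℝ) + (I.d : ℝ)) * f ((I.c : ℝ) / (I.d : ℝ))

/-- The renormalized Hata coefficient `T_I(f) = (b + d) c_I(f)`. -/
def hataT (f : ℝ → ℝ) (I : FareyInterval) : ℝ :=
  ((I.b : ℝ) + (I.d : ℝ)) * hataCoeff f I

/-- The term `|T_I(f)| ^ s` of the Farey zeta series. -/
def fareyTerm (f : ℝ → ℝ) (s : ℂ) (I : FareyInterval) : ℂ :=
  ((|hataT f I| : ℝ) : ℂ) ^ s

/-- The Farey zeta function `Z_f(s) = ∑_I |T_I(f)| ^ s`, as the sum of its series. -/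
def fareyZeta (f : ℝ → ℝ) (s : ℂ) : ℂ :=
  ∑' I : FareyInterval, fareyTerm f s I

/-- The second derivative of `f` on the closed interval `[0, 1]` (one-sided at the ends). -/
def secondDeriv (f : ℝ → ℝ) (x : ℝ) : ℝ :=
  iteratedDerivWithin 2 f (Icc (0 : ℝ) 1) x

end

/-! ### Divisor and gcd sums. -/

section DivisorBounds

/-! The coefficient is a second difference over the three points `c/d`, the mediant and `a/b`, so
the mean value theorem gives `T_I(f) = -f''(ξ) / (2bd(b+d))` with `ξ` in `I` (`exists_hataT_eq`).
Since `f''` does not vanish, `|T_I|^s = exp(s l(ξ)) (bd(b+d))^(-s)` with `l = log(|f''|/2)`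
Lipschitz. Because `bd(b+d) ≥ (bd)^(3/2)` and `(b, d)` determines `I`, the series converges for `Re
s > 2/3`.

For the continuation, reflection `x ↦ 1 - x` reduces the sum to intervals with `d ≤ b`. Moving `ξ`
to the left endpoint `c/d` costs `O(1/(bd))` per term, which leaves a series holomorphic for `Re s >
1/2`. Write `b = r + (k+1)d` with `r` a unit modulo `d`; then `c ≡ -r⁻¹`, and summing over `k` turns
the series into `∑_d d^(-3s) ∑_r ψ(-r⁻¹/d) H(r/d)`, where `ψ = exp(s l)` and `H(x) = ∑_k
((x+k+1)(x+k+2))^(-s)`.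

The pairs `(-r⁻¹, r)` are equidistributed: finite Fourier expansion brings in Kloosterman sums, and
Kloosterman's fourth moment bound (`norm_kloosterman_le`) shows that the inner sum is `φ(d) ∫ψ ∫H +
O(d^(5/6))`. The errors sum to a holomorphic function for `Re s > 11/18`, which contains the disk
because `1/21 < 1/18`. The main term is `ζ(3s-1)/ζ(3s) ∫ψ ∫H`, whose only singularity there is the
pole of `ζ(3s-1)`. At `s = 2/3` the kernel mean unfolds to `∫_1^∞ (y(y+1))^(-2/3) dy`, which is half
of the Beta value `B(1/3, 1/3)`; this yields the residue. -/

theorem natCast_add_one_le_mul_two_rpow {ε : ℝ} (hε : 0 < ε) (k : ℕ) :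
    (k : ℝ) + 1 ≤ (1 + 1 / (ε * Real.log 2)) * ((2 : ℝ) ^ ε) ^ k := by
  have hlog : 0 < Real.log 2 := Real.log_pos one_lt_two
  have h1 : 1 + k * (ε * Real.log 2) ≤ ((2 : ℝ) ^ ε) ^ k := by
    rw [← Real.rpow_natCast, ← Real.rpow_mul zero_le_two, Real.rpow_def_of_pos two_pos]
    have := Real.add_one_le_exp (Real.log 2 * (ε * k))
    linarith
  have hc : 0 < ε * Real.log 2 := by positivity
  have h2 : (k : ℝ) + 1 ≤ (1 + 1 / (ε * Real.log 2)) * (1 + k * (ε * Real.log 2)) := by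
    have : (1 + 1 / (ε * Real.log 2)) * (1 + k * (ε * Real.log 2))
        = 1 + k + k * (ε * Real.log 2) + 1 / (ε * Real.log 2) := by
      field_simp; ring
    rw [this]
    have : 0 ≤ k * (ε * Real.log 2) + 1 / (ε * Real.log 2) := by positivity
    linarith
  exact h2.trans (by gcongr)

/-- The divisor bound: `τ(n) = O(n ^ ε)` for every `ε > 0`. -/
theorem exists_card_divisors_le_rpow {ε : ℝ} (hε : 0 < ε) :
    ∃ C : ℝ, 0 < C ∧ ∀ n : ℕ, n ≠ 0 → (n.divisors.card : ℝ) ≤ C * (n : ℝ) ^ ε := by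
  set A : ℝ := 1 + 1 / (ε * Real.log 2) with hA
  have hlog : 0 < Real.log 2 := Real.log_pos one_lt_two
  have hA1 : 1 ≤ A := by
    have : 0 ≤ 1 / (ε * Real.log 2) := by positivity
    linarith
  -- A prime `p ≥ 2^(1/ε)` has `p^ε ≥ 2`, so `k + 1 ≤ 2^k ≤ p^(εk)` without loss. At most `P`
  -- smaller primes each cost a factor `A`.
  obtain ⟨P, hP⟩ := exists_nat_ge ((2 : ℝ) ^ (1 / ε))
  refine ⟨A ^ P, by positivity, fun n hn => ?_⟩
  have hn' : (n : ℝ) ^ ε = ∏ p ∈ n.primeFactors, ((p : ℝ) ^ ε) ^ (n.factorization p) := by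
    conv_lhs => rw [← Nat.prod_factorization_pow_eq_self hn]
    rw [Finsupp.prod, Nat.support_factorization]
    push_cast
    rw [← Real.finsetProd_rpow _ _ (fun i _ => by positivity)]
    refine Finset.prod_congr rfl fun p _ => ?_
    rw [← Real.rpow_natCast, ← Real.rpow_natCast, ← Real.rpow_mul (by positivity),
      ← Real.rpow_mul (by positivity), mul_comm]
  have hterm : ∀ p ∈ n.primeFactors, ((n.factorization p : ℝ) + 1)
      ≤ (if p < P then A else 1) * ((p : ℝ) ^ ε) ^ (n.factorization p) := by
    intro p hp
    have hp2 : (2 : ℝ) ≤ p := by exact_mod_cast (Nat.prime_of_mem_primeFactors hp).two_le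
    split_ifs with h
    · refine (natCast_add_one_le_mul_two_rpow hε _).trans ?_
      gcongr
    · have hPp : (2 : ℝ) ^ (1 / ε) ≤ p := hP.trans (by exact_mod_cast not_lt.mp h)
      have h2 : (2 : ℝ) ≤ (p : ℝ) ^ ε := by
        calc (2 : ℝ) = ((2 : ℝ) ^ (1 / ε)) ^ ε := by
              rw [← Real.rpow_mul zero_le_two, one_div_mul_cancel hε.ne', Real.rpow_one]
          _ ≤ _ := by gcongr
      rw [one_mul]
      calc (n.factorization p : ℝ) + 1 ≤ 2 ^ (n.factorization p) := by
            exact_mod_cast Nat.lt_two_pow_self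
        _ ≤ _ := by gcongr
  rw [Nat.card_divisors hn, hn']
  push_cast
  refine (Finset.prod_le_prod (fun _ _ => by positivity) hterm).trans ?_
  rw [Finset.prod_mul_distrib]
  gcongr
  rw [Finset.prod_ite, Finset.prod_const_one, mul_one, Finset.prod_const]
  refine pow_le_pow_right₀ hA1 ?_
  calc _ ≤ (Finset.range P).card := Finset.card_le_card fun p hp => by
        simp only [Finset.mem_filter] at hp
        exact Finset.mem_range.mpr hp.2
    _ = P := Finset.card_range P

theorem gcd_le_sum_divisors_ite {d : ℕ} (hd : d ≠ 0) (m : ℕ) :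
    Nat.gcd m d ≤ ∑ g ∈ d.divisors, if g ∣ m then g else 0 := by
  have hmem : Nat.gcd m d ∈ d.divisors := Nat.mem_divisors.mpr ⟨Nat.gcd_dvd_right m d, hd⟩
  refine le_trans ?_ (Finset.single_le_sum (f := fun g => if g ∣ m then g else 0)
    (fun _ _ => Nat.zero_le _) hmem)
  simp [Nat.gcd_dvd_left]

/-- Bound the gcd by the sum of all common divisors and exchange sums: each `g ∣ d` divides `d/g` of
the integers and so contributes exactly `d`. -/
theorem sum_Ioc_gcd_le {d : ℕ} (hd : d ≠ 0) :
    ∑ m ∈ Finset.Ioc 0 d, Nat.gcd m d ≤ d * d.divisors.card := by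
  calc ∑ m ∈ Finset.Ioc 0 d, Nat.gcd m d
      ≤ ∑ m ∈ Finset.Ioc 0 d, ∑ g ∈ d.divisors, (if g ∣ m then g else 0) :=
        Finset.sum_le_sum fun m _ => gcd_le_sum_divisors_ite hd m
    _ = ∑ g ∈ d.divisors, ∑ m ∈ Finset.Ioc 0 d, (if g ∣ m then g else 0) := Finset.sum_comm
    _ = ∑ g ∈ d.divisors, d := by
        refine Finset.sum_congr rfl fun g hg => ?_
        rw [← Finset.sum_filter, Finset.sum_const, Nat.Ioc_filter_dvd_card_eq_div, smul_eq_mul,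
          Nat.div_mul_cancel (Nat.dvd_of_mem_divisors hg)]
    _ = d * d.divisors.card := by rw [Finset.sum_const, smul_eq_mul, mul_comm]

/-- After the same exchange, a multiple `m = gk` contributes `g/m = 1/k`, so every divisor costs at
most one harmonic sum. -/
theorem sum_Ioc_gcd_div_le {d : ℕ} (hd : d ≠ 0) :
    ∑ m ∈ Finset.Ioc 0 d, (Nat.gcd m d : ℝ) / m ≤ d.divisors.card * (1 + Real.log d) := by
  have hH : ∑ k ∈ Finset.Ioc 0 d, (1 : ℝ) / k ≤ 1 + Real.log d := by
    have := harmonic_le_one_add_log d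
    rw [harmonic_eq_sum_Icc] at this
    push_cast at this
    simpa [one_div, ← Finset.Icc_succ_left_eq_Ioc] using this
  have hmul : ∀ g ∈ d.divisors, ∑ m ∈ Finset.Ioc 0 d, (if g ∣ m then (g : ℝ) else 0) / m
      ≤ 1 + Real.log d := by
    intro g hg
    have hg0 : 0 < g := Nat.pos_of_mem_divisors hg
    refine le_trans ?_ hH
    simp only [ite_div, zero_div]
    rw [← Finset.sum_filter]
    have hsub : (Finset.Ioc 0 d).filter (g ∣ ·) ⊆ (Finset.Ioc 0 d).image (g * ·) := by
      intro m hm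
      obtain ⟨hm, k, rfl⟩ := Finset.mem_filter.mp hm
      rw [Finset.mem_Ioc] at hm
      refine Finset.mem_image.mpr ⟨k, Finset.mem_Ioc.mpr ⟨Nat.pos_of_mul_pos_left hm.1, ?_⟩, rfl⟩
      exact (Nat.le_mul_of_pos_left k hg0).trans hm.2
    refine (Finset.sum_le_sum_of_subset_of_nonneg hsub fun _ _ _ => by positivity).trans ?_
    rw [Finset.sum_image fun x _ y _ h => Nat.eq_of_mul_eq_mul_left hg0 h]
    refine le_of_eq (Finset.sum_congr rfl fun k hk => ?_)
    have : (k : ℝ) ≠ 0 := by exact_mod_cast (Finset.mem_Ioc.mp hk).1.ne'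
    push_cast
    field_simp
  calc ∑ m ∈ Finset.Ioc 0 d, (Nat.gcd m d : ℝ) / m
      ≤ ∑ m ∈ Finset.Ioc 0 d, ∑ g ∈ d.divisors, (if g ∣ m then (g : ℝ) else 0) / m := by
        refine Finset.sum_le_sum fun m _ => ?_
        rw [← Finset.sum_div]
        gcongr
        exact_mod_cast gcd_le_sum_divisors_ite hd m
    _ = ∑ g ∈ d.divisors, ∑ m ∈ Finset.Ioc 0 d, (if g ∣ m then (g : ℝ) else 0) / m :=
        Finset.sum_comm
    _ ≤ ∑ g ∈ d.divisors, (1 + Real.log d) := Finset.sum_le_sum hmul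
    _ = _ := by rw [Finset.sum_const, nsmul_eq_mul]

/-- In `∑_{g ∣ d} φ(g) = d` each term divides `φ(d)`. -/
theorem le_totient_mul_card_divisors (d : ℕ) : d ≤ d.totient * d.divisors.card := by
  rcases Nat.eq_zero_or_pos d with rfl | hd
  · simp
  conv_lhs => rw [← Nat.sum_totient d]
  rw [mul_comm, ← smul_eq_mul]
  refine Finset.sum_le_card_nsmul _ _ _ fun g hg => ?_
  exact Nat.le_of_dvd (Nat.totient_pos.mpr hd) (Nat.totient_dvd_of_dvd (Nat.dvd_of_mem_divisors hg))

end DivisorBounds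

/-! ### Counting solutions of congruences. -/

section ZModCounting

variable {d : ℕ} [NeZero d]

/-- By Bézout a solution is killed by `gcd(m, d)`, and a cyclic group has at most `n` elements
killed by `n`. -/
theorem card_filter_mul_eq_zero_le (m : ℕ) :
    (Finset.univ.filter fun t : ZMod d => (m : ZMod d) * t = 0).card ≤ Nat.gcd m d := by
  have hpos : 0 < Nat.gcd m d := Nat.gcd_pos_of_pos_right _ (NeZero.pos d)
  refine le_trans (Finset.card_le_card ?_)
    (IsAddCyclic.card_nsmul_eq_zero_le (α := ZMod d) hpos)
  intro t ht
  simp only [Finset.mem_filter, Finset.mem_univ, true_and] at ht ⊢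
  rw [nsmul_eq_mul]
  have h : ((Nat.gcd m d : ℕ) : ZMod d) = (m : ZMod d) * ((m.gcdA d : ℤ) : ZMod d) := by
    have := congrArg (fun z : ℤ => (z : ZMod d)) (Nat.gcd_eq_gcd_ab m d)
    push_cast at this
    simpa using this
  rw [h, mul_right_comm, ht, zero_mul]

theorem card_filter_mul_eq_le (m : ℕ) (c : ZMod d) :
    (Finset.univ.filter fun t : ZMod d => (m : ZMod d) * t = c).card ≤ Nat.gcd m d := by
  rcases (Finset.univ.filter fun t : ZMod d => (m : ZMod d) * t = c).eq_empty_or_nonempty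
    with h | ⟨t₀, ht₀⟩
  · rw [h]; simp
  · refine le_trans ?_ (card_filter_mul_eq_zero_le m)
    refine Finset.card_le_card_of_injOn (fun t => t - t₀) ?_ (sub_left_injective.injOn)
    intro t ht
    simp only [Finset.coe_filter, Finset.mem_filter, Finset.mem_univ, true_and,
      Set.mem_ofPred_eq] at ht ht₀ ⊢
    rw [mul_sub, ht, ht₀, sub_self]

theorem sum_zmod_gcd_val_le : ∑ a : ZMod d, Nat.gcd a.val d ≤ d * d.divisors.card := by
  refine le_trans (le_of_eq ?_) (sum_Ioc_gcd_le (NeZero.ne d))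
  have h : ∑ m ∈ Finset.range d, Nat.gcd m d = ∑ m ∈ Finset.Ioc 0 d, Nat.gcd m d := by
    have h1 := Finset.sum_range_succ (fun m => Nat.gcd m d) d
    have h2 := Finset.sum_range_succ' (fun m => Nat.gcd m d) d
    have h3 : ∑ m ∈ Finset.Ioc 0 d, Nat.gcd m d = ∑ m ∈ Finset.range d, Nat.gcd (m + 1) d := by
      rw [← Finset.Ico_add_one_add_one_eq_Ioc, Finset.sum_Ico_eq_sum_range]
      simp [add_comm]
    rw [h3]
    simp at h1 h2
    omega
  rw [← h]
  obtain ⟨n, rfl⟩ : ∃ n, d = n + 1 := ⟨d - 1, by have := NeZero.pos d; omega⟩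
  exact (Fin.sum_univ_eq_sum_range (fun m => Nat.gcd m (n + 1)) (n + 1))

/-- For fixed `a`, `b` there are at most `gcd(ab, d) ≤ gcd(a, d) gcd(b, d)` choices of the third
factor, and the double sum of these splits into a product. -/
theorem card_filter_mul_mul_eq_zero_le :
    (Finset.univ.filter fun p : ZMod d × ZMod d × ZMod d => p.1 * p.2.1 * p.2.2 = 0).card
      ≤ d ^ 2 * d.divisors.card ^ 2 := by
  calc _ = ∑ a : ZMod d, ∑ b : ZMod d,
        (Finset.univ.filter fun c : ZMod d => a * b * c = 0).card := by
        simp only [Finset.card_filter, Fintype.sum_prod_type]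
    _ ≤ ∑ a : ZMod d, ∑ b : ZMod d, Nat.gcd a.val d * Nat.gcd b.val d := by
        refine Finset.sum_le_sum fun a _ => Finset.sum_le_sum fun b _ => ?_
        have h := card_filter_mul_eq_zero_le (d := d) (a.val * b.val)
        push_cast at h
        simp only [ZMod.natCast_val, ZMod.cast_id', id_eq] at h
        exact h.trans (Nat.le_of_dvd (by
          have := NeZero.pos d
          exact Nat.mul_pos (Nat.gcd_pos_of_pos_right _ this) (Nat.gcd_pos_of_pos_right _ this))
          (Nat.gcd_mul_left_dvd_mul_gcd _ _ _))
    _ = (∑ a : ZMod d, Nat.gcd a.val d) * ∑ b : ZMod d, Nat.gcd b.val d := by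
        rw [Finset.sum_mul_sum]
    _ ≤ (d * d.divisors.card) * (d * d.divisors.card) :=
        Nat.mul_le_mul sum_zmod_gcd_val_le sum_zmod_gcd_val_le
    _ = _ := by ring

end ZModCounting

noncomputable section

/-! ### Kloosterman's bound by the fourth moment. -/

section Kloosterman

variable {d : ℕ} [NeZero d]

/-- The Kloosterman sum `K(u, v; d) = ∑_x e((u x + v x⁻¹) / d)` over the units modulo `d`. -/
def kloosterman (u v : ZMod d) : ℂ :=
  ∑ x : (ZMod d)ˣ, ZMod.stdAddChar (u * (x : ZMod d) + v * ((x⁻¹ : (ZMod d)ˣ) : ZMod d))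

theorem kloosterman_comm (u v : ZMod d) : kloosterman u v = kloosterman v u := by
  unfold kloosterman
  refine Fintype.sum_equiv (Equiv.inv _) _ _ fun x => ?_
  simp [add_comm]

/-- Substitute `x ↦ tx`. One large sum thus forces `φ(d)` equally large ones, which is what makes a
moment over all pairs useful for a single sum. -/
theorem kloosterman_twist (u v : ZMod d) (t : (ZMod d)ˣ) :
    kloosterman (u * (t : ZMod d)) (v * ((t⁻¹ : (ZMod d)ˣ) : ZMod d)) = kloosterman u v := by
  unfold kloosterman
  refine Fintype.sum_equiv (Equiv.mulLeft t) _ _ fun x => ?_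
  simp only [Equiv.coe_mulLeft, mul_inv_rev, Units.val_mul]
  congr 1
  ring

/-- Quadruples of units with `x₁ + x₂ = x₃ + x₄` and `x₁⁻¹ + x₂⁻¹ = x₃⁻¹ + x₄⁻¹`. -/
def unitQuadruples (d : ℕ) [NeZero d] :
    Finset ((ZMod d)ˣ × (ZMod d)ˣ × (ZMod d)ˣ × (ZMod d)ˣ) :=
  Finset.univ.filter fun x =>
    (x.1 : ZMod d) + x.2.1 - x.2.2.1 - x.2.2.2 = 0 ∧
    ((x.1⁻¹ : (ZMod d)ˣ) : ZMod d) + ((x.2.1⁻¹ : (ZMod d)ˣ) : ZMod d) - ((x.2.2.1⁻¹ : (ZMod d)ˣ) : ZMod d)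
      - ((x.2.2.2⁻¹ : (ZMod d)ˣ) : ZMod d) = 0

theorem conj_stdAddChar (x : ZMod d) :
    (starRingEnd ℂ) (ZMod.stdAddChar x) = ZMod.stdAddChar (-x) :=
  by rw [AddChar.map_neg_eq_conj]

theorem sum_stdAddChar_mul (b : ZMod d) :
    ∑ x : ZMod d, (ZMod.stdAddChar (x * b) : ℂ) = if b = 0 then (d : ℂ) else 0 := by
  have := AddChar.sum_mulShift b (ZMod.isPrimitive_stdAddChar d)
  simpa [ZMod.card] using this

theorem norm_kloosterman_pow_four (u v : ZMod d) :
    ((‖kloosterman u v‖ ^ 4 : ℝ) : ℂ) =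
      ∑ x : (ZMod d)ˣ × (ZMod d)ˣ × (ZMod d)ˣ × (ZMod d)ˣ,
        ZMod.stdAddChar (u * ((x.1 : ZMod d) + (x.2.1 : ZMod d) - (x.2.2.1 : ZMod d)
          - (x.2.2.2 : ZMod d))) *
        ZMod.stdAddChar (v * (((x.1⁻¹ : (ZMod d)ˣ) : ZMod d) + ((x.2.1⁻¹ : (ZMod d)ˣ) : ZMod d)
          - ((x.2.2.1⁻¹ : (ZMod d)ˣ) : ZMod d) - ((x.2.2.2⁻¹ : (ZMod d)ˣ) : ZMod d))) := by
  set e : (ZMod d)ˣ → ℂ := fun x =>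
    ZMod.stdAddChar (u * (x : ZMod d) + v * ((x⁻¹ : (ZMod d)ˣ) : ZMod d)) with he
  have hK : kloosterman u v = ∑ x, e x := rfl
  have h : ((‖kloosterman u v‖ ^ 4 : ℝ) : ℂ)
      = (∑ x, e x) * ((∑ x, e x) * ((∑ x, (starRingEnd ℂ) (e x)) *
        ∑ x, (starRingEnd ℂ) (e x))) := by
    have := Complex.mul_conj' (kloosterman u v)
    rw [← map_sum (starRingEnd ℂ), ← hK]
    push_cast
    linear_combination -(kloosterman u v * (starRingEnd ℂ) (kloosterman u v)
      + (‖kloosterman u v‖ : ℂ) ^ 2) * this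
  have hterm : ∀ x : (ZMod d)ˣ × (ZMod d)ˣ × (ZMod d)ˣ × (ZMod d)ˣ,
        (ZMod.stdAddChar (u * ((x.1 : ZMod d) + (x.2.1 : ZMod d) - (x.2.2.1 : ZMod d)
          - (x.2.2.2 : ZMod d))) *
        ZMod.stdAddChar (v * (((x.1⁻¹ : (ZMod d)ˣ) : ZMod d) + ((x.2.1⁻¹ : (ZMod d)ˣ) : ZMod d)
          - ((x.2.2.1⁻¹ : (ZMod d)ˣ) : ZMod d) - ((x.2.2.2⁻¹ : (ZMod d)ˣ) : ZMod d))) : ℂ)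
        = e x.1 * (e x.2.1 * ((starRingEnd ℂ) (e x.2.2.1) * (starRingEnd ℂ) (e x.2.2.2))) := by
    intro x
    simp only [he, conj_stdAddChar, ← AddChar.map_add_eq_mul]
    congr 1
    ring
  rw [h, Finset.sum_congr rfl fun x _ => hterm x]
  simp only [Fintype.sum_prod_type, ← Finset.mul_sum, ← Finset.sum_mul]

/-- Orthogonality in `u` and in `v` detects the two equations defining `unitQuadruples`, each with
weight `d`. -/
theorem sum_norm_kloosterman_pow_four :
    ∑ u : ZMod d, ∑ v : ZMod d, ‖kloosterman u v‖ ^ 4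
      = (d : ℝ) ^ 2 * (unitQuadruples d).card := by
  have h : ((∑ u : ZMod d, ∑ v : ZMod d, ‖kloosterman u v‖ ^ 4 : ℝ) : ℂ)
      = ((d : ℝ) ^ 2 * (unitQuadruples d).card : ℝ) := by
    rw [Complex.ofReal_sum]
    simp only [Complex.ofReal_sum, norm_kloosterman_pow_four]
    have h1 : ∀ u : ZMod d, ∑ v : ZMod d, ∑ x : (ZMod d)ˣ × (ZMod d)ˣ × (ZMod d)ˣ × (ZMod d)ˣ,
        (ZMod.stdAddChar (u * ((x.1 : ZMod d) + (x.2.1 : ZMod d) - (x.2.2.1 : ZMod d)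
          - (x.2.2.2 : ZMod d))) *
        ZMod.stdAddChar (v * (((x.1⁻¹ : (ZMod d)ˣ) : ZMod d) + ((x.2.1⁻¹ : (ZMod d)ˣ) : ZMod d)
          - ((x.2.2.1⁻¹ : (ZMod d)ˣ) : ZMod d) - ((x.2.2.2⁻¹ : (ZMod d)ˣ) : ZMod d))) : ℂ)
        = ∑ x : (ZMod d)ˣ × (ZMod d)ˣ × (ZMod d)ˣ × (ZMod d)ˣ,
          ZMod.stdAddChar (u * ((x.1 : ZMod d) + (x.2.1 : ZMod d) - (x.2.2.1 : ZMod d)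
          - (x.2.2.2 : ZMod d))) *
          (if ((x.1⁻¹ : (ZMod d)ˣ) : ZMod d) + ((x.2.1⁻¹ : (ZMod d)ˣ) : ZMod d)
          - ((x.2.2.1⁻¹ : (ZMod d)ˣ) : ZMod d) - ((x.2.2.2⁻¹ : (ZMod d)ˣ) : ZMod d) = 0 then (d : ℂ) else 0) := by
      intro u
      rw [Finset.sum_comm]
      exact Finset.sum_congr rfl fun x _ => by rw [← Finset.mul_sum, sum_stdAddChar_mul]
    simp only [h1]
    rw [Finset.sum_comm]
    simp only [← Finset.sum_mul, sum_stdAddChar_mul]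
    rw [unitQuadruples, Finset.card_filter]
    push_cast
    rw [Finset.mul_sum]
    refine Finset.sum_congr rfl fun x _ => ?_
    split_ifs <;> simp_all [sq]
  exact_mod_cast h

/-- Clearing denominators in the second equation gives `(x₁ + x₂)(x₃x₄ - x₁x₂) = 0`; with `x₄ = x₁ +
x₂ - x₃` the second factor is `-(x₃ - x₁)(x₃ - x₂)`. -/
theorem unitQuadruples_mul_eq_zero {x : (ZMod d)ˣ × (ZMod d)ˣ × (ZMod d)ˣ × (ZMod d)ˣ}
    (hx : x ∈ unitQuadruples d) :
    ((x.1 : ZMod d) + x.2.1) * (x.2.2.1 - x.1) * (x.2.2.1 - x.2.1) = 0 := by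
  obtain ⟨x₁, x₂, x₃, x₄⟩ := x
  simp only [unitQuadruples, Finset.mem_filter, Finset.mem_univ, true_and] at hx ⊢
  obtain ⟨h1, h2⟩ := hx
  have e1 := x₁.mul_inv
  have e2 := x₂.mul_inv
  have e3 := x₃.mul_inv
  have e4 := x₄.mul_inv
  have h4 : (x₄ : ZMod d) = x₁ + x₂ - x₃ := by linear_combination -h1
  have h5 : ((x₁ : ZMod d) + x₂) * x₃ * x₄ = (x₃ + x₄) * x₁ * x₂ := by
    have h6 := congrArg (fun z => z * ((x₁ : ZMod d) * x₂ * x₃ * x₄)) h2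
    simp only [zero_mul] at h6
    linear_combination h6 - (x₂ * x₃ * x₄ : ZMod d) * e1 - (x₁ * x₃ * x₄ : ZMod d) * e2
      + (x₁ * x₂ * x₄ : ZMod d) * e3 + (x₁ * x₂ * x₃ : ZMod d) * e4
  rw [h4] at h5
  linear_combination -h5

theorem card_unitQuadruples_le :
    (unitQuadruples d).card ≤ 2 * (d ^ 2 * d.divisors.card ^ 2) := by
  refine (Finset.card_le_mul_card_image (f := fun x => ((x.1 : ZMod d) + x.2.1,
    (x.2.2.1 : ZMod d) - x.1, (x.2.2.1 : ZMod d) - x.2.1)) _ 2 ?_).trans ?_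
  · intro p _
    -- The combination `p₁ + p₂ - p₃` equals `2x₂`, so a fibre allows at most `gcd(2, d) ≤ 2` values
    -- of `x₂`, and `x₂` determines the rest.
    refine le_trans ?_ ((card_filter_mul_eq_le (d := d) 2 (p.1 + p.2.1 - p.2.2)).trans
      (Nat.gcd_le_left _ two_pos))
    refine Finset.card_le_card_of_injOn (fun x => (x.2.1 : ZMod d)) ?_ ?_
    · rintro ⟨x₁, x₂, x₃, x₄⟩ hx
      simp only [Finset.coe_filter, Finset.mem_univ, true_and,
        Set.mem_ofPred_eq] at hx ⊢
      rw [← hx.2]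
      push_cast
      ring
    · rintro ⟨x₁, x₂, x₃, x₄⟩ hx ⟨y₁, y₂, y₃, y₄⟩ hy hxy
      simp only [Finset.coe_filter, Set.mem_ofPred_eq, unitQuadruples, Finset.mem_filter,
        Finset.mem_univ, true_and] at hx hy hxy
      obtain ⟨⟨hx1, -⟩, rfl⟩ := hx
      obtain ⟨⟨hy1, -⟩, hy2⟩ := hy
      simp only [Prod.mk.injEq] at hy2
      obtain ⟨ha, hb, hc⟩ := hy2
      have h2 : x₂ = y₂ := Units.ext hxy
      have h1 : x₁ = y₁ := Units.ext (by linear_combination -ha - hxy)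
      have h3 : x₃ = y₃ := Units.ext (by linear_combination -hc + hxy)
      have h4 : x₄ = y₄ := Units.ext (by
        subst h1 h2 h3
        linear_combination hy1 - hx1)
      rw [h1, h2, h3, h4]
  · refine Nat.mul_le_mul_left _ (le_trans (Finset.card_le_card ?_) card_filter_mul_mul_eq_zero_le)
    intro p hp
    obtain ⟨x, hx, rfl⟩ := Finset.mem_image.mp hp
    simpa using unitQuadruples_mul_eq_zero hx

/-- The `φ(d)` twists of `(u, v)` all occur in the full moment. A pair is hit at most `gcd(u, d)`
times, as its first coordinate `ut` already shows. -/
theorem totient_mul_norm_kloosterman_pow_four_le (u v : ZMod d) :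
    (d.totient : ℝ) * ‖kloosterman u v‖ ^ 4
      ≤ Nat.gcd u.val d * ∑ a : ZMod d, ∑ b : ZMod d, ‖kloosterman a b‖ ^ 4 := by
  have h1 : (d.totient : ℝ) * ‖kloosterman u v‖ ^ 4
      = ∑ t : (ZMod d)ˣ, ‖kloosterman (u * (t : ZMod d)) (v * ((t⁻¹ : (ZMod d)ˣ) : ZMod d))‖ ^ 4 := by
    simp only [kloosterman_twist, Finset.sum_const, Finset.card_univ, nsmul_eq_mul,
      ZMod.card_units_eq_totient]
  have h2 : ∑ t : (ZMod d)ˣ, ‖kloosterman (u * (t : ZMod d)) (v * ((t⁻¹ : (ZMod d)ˣ) : ZMod d))‖ ^ 4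
      = ∑ p : ZMod d × ZMod d, ∑ t ∈ Finset.univ.filter
          (fun t : (ZMod d)ˣ => (u * t, v * ((t⁻¹ : (ZMod d)ˣ) : ZMod d)) = p),
          ‖kloosterman p.1 p.2‖ ^ 4 := by
    rw [← Finset.sum_fiberwise (s := Finset.univ)
      (g := fun t : (ZMod d)ˣ => (u * (t : ZMod d), v * ((t⁻¹ : (ZMod d)ˣ) : ZMod d)))]
    refine Finset.sum_congr rfl fun p _ => Finset.sum_congr rfl fun t ht => ?_
    rw [← (Finset.mem_filter.mp ht).2]
  rw [h1, h2, ← Fintype.sum_prod_type', Finset.mul_sum]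
  refine Finset.sum_le_sum fun p _ => ?_
  rw [Finset.sum_const, nsmul_eq_mul]
  gcongr
  have h3 := card_filter_mul_eq_le u.val p.1
  refine le_trans (Finset.card_le_card_of_injOn (fun t : (ZMod d)ˣ => (t : ZMod d)) ?_
    (Units.val_injective.injOn)) h3
  intro t ht
  simp only [Finset.coe_filter, Finset.mem_univ, true_and, Set.mem_ofPred_eq] at ht ⊢
  rw [← ht]
  simp

/-- Kloosterman's bound for `K(u, v; d)`, with the loss of a common divisor. -/
theorem norm_kloosterman_le (u v : ZMod d) :
    ‖kloosterman u v‖ ≤ 2 * Nat.gcd u.val d * d.divisors.card * (d : ℝ) ^ (3 / 4 : ℝ) := by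
  have hd : (0 : ℝ) < d := by exact_mod_cast NeZero.pos d
  have hτ : (1 : ℝ) ≤ d.divisors.card := by
    exact_mod_cast Finset.card_pos.mpr ⟨1, Nat.one_mem_divisors.mpr (NeZero.ne d)⟩
  have hg : (1 : ℝ) ≤ Nat.gcd u.val d := by
    exact_mod_cast Nat.gcd_pos_of_pos_right _ (NeZero.pos d)
  have h1 := totient_mul_norm_kloosterman_pow_four_le u v
  rw [sum_norm_kloosterman_pow_four] at h1
  have h2 : ((unitQuadruples d).card : ℝ) ≤ 2 * (d ^ 2 * d.divisors.card ^ 2) := by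
    exact_mod_cast card_unitQuadruples_le (d := d)
  have h3 : (d : ℝ) ≤ d.totient * d.divisors.card := by
    exact_mod_cast le_totient_mul_card_divisors d
  set τ : ℝ := (d.divisors.card : ℝ)
  set g : ℝ := (Nat.gcd u.val d : ℝ)
  set K := ‖kloosterman u v‖
  have h4 : (d : ℝ) * K ^ 4 ≤ d * (2 * g * τ ^ 3 * d ^ 3) := by
    calc (d : ℝ) * K ^ 4 ≤ (d.totient * τ) * K ^ 4 := by gcongr
      _ = τ * (d.totient * K ^ 4) := by ring
      _ ≤ τ * (g * ((d : ℝ) ^ 2 * (2 * (d ^ 2 * τ ^ 2)))) := by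
          exact mul_le_mul_of_nonneg_left (h1.trans (by gcongr)) (by positivity)
      _ = _ := by ring
  have h5 : K ^ 4 ≤ 2 * g * τ ^ 3 * d ^ 3 := le_of_mul_le_mul_left h4 hd
  -- The fourth root is taken crudely: `2`, `g` and `τ` are all at least `1`, so only the exponent
  -- `3/4` of `d` matters.
  refine le_of_pow_le_pow_left₀ (n := 4) (by norm_num) (by positivity) (h5.trans ?_)
  have h6 : ((d : ℝ) ^ (3 / 4 : ℝ)) ^ 4 = d ^ 3 := by
    rw [← Real.rpow_natCast, ← Real.rpow_mul hd.le]
    norm_num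
  rw [mul_pow, mul_pow, mul_pow, h6]
  gcongr
  · norm_num
  · exact le_self_pow₀ hg (by norm_num)
  · norm_num

end Kloosterman


/-! ### Decay of finite Fourier coefficients. -/

section FourierCoefficients

variable {d : ℕ} [NeZero d]

/-- The distance is `2 |sin(πm/d)|`, and Jordan's inequality bounds it below by `4 min(m, d-m) / d`.
The sum of the two reciprocals replaces the reciprocal of the minimum. -/
theorem le_norm_stdAddChar_sub_one (m : ZMod d) (hm : m ≠ 0) :
    1 ≤ (d : ℝ) / 4 * ((1 : ℝ) / m.val + 1 / (d - m.val : ℝ)) *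
      ‖(ZMod.stdAddChar m : ℂ) - 1‖ := by
  have hm0 : 0 < m.val := Nat.pos_of_ne_zero fun h => hm ((ZMod.val_eq_zero m).mp h)
  have hmd : m.val < d := ZMod.val_lt m
  have hd : (0 : ℝ) < d := by exact_mod_cast NeZero.pos d
  have hme : (ZMod.stdAddChar m : ℂ) = Complex.exp (Complex.I * ((2 * Real.pi * m.val / d : ℝ) : ℂ)) := by
    have := ZMod.stdAddChar_coe (N := d) (m.val : ℤ)
    rw [Int.cast_natCast, ZMod.natCast_zmod_val, Int.cast_natCast] at this
    rw [this]
    congr 1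
    push_cast
    simp
    ring
  rw [hme, Complex.norm_exp_I_mul_ofReal_sub_one]
  set k : ℝ := (m.val : ℝ) with hk
  have hk0 : 0 < k := Nat.cast_pos.mpr hm0
  have hkd : 0 < d - k := sub_pos.mpr (Nat.cast_lt.mpr hmd)
  have hπ := Real.pi_pos
  have hmin : ∀ t : ℝ, 0 < t → t ≤ d / 2 → 4 * t / d ≤ ‖2 * Real.sin (Real.pi * t / d)‖ := by
    intro t ht htd
    have h1 : 0 ≤ Real.pi * t / d := by positivity
    have h2 : Real.pi * t / d ≤ Real.pi / 2 := by
      rw [div_le_div_iff₀ hd two_pos]; nlinarith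
    have h3 := Real.mul_le_sin h1 h2
    rw [norm_mul, Real.norm_eq_abs, Real.norm_eq_abs, abs_two]
    refine le_trans ?_ (mul_le_mul_of_nonneg_left (h3.trans (le_abs_self _)) zero_le_two)
    apply le_of_eq
    field_simp
    ring
  have hsum : (1 : ℝ) / k + 1 / (d - k) = d / (k * (d - k)) := by field_simp; ring
  rcases le_total k (d / 2) with h | h
  · have h1 := hmin k hk0 h
    have h2 : 2 * Real.pi * k / d / 2 = Real.pi * k / d := by ring
    rw [h2]
    calc (1 : ℝ) ≤ d / 4 * (1 / k) * (4 * k / d) := by apply le_of_eq; field_simp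
      _ ≤ _ := by
        gcongr
        have : (0 : ℝ) < 1 / (d - k) := by positivity
        linarith
  · have h1 := hmin (d - k) hkd (by linarith)
    have h2 : Real.sin (2 * Real.pi * k / d / 2) = Real.sin (Real.pi * (d - k) / d) := by
      rw [← Real.sin_pi_sub]
      congr 1
      field_simp
    rw [h2]
    calc (1 : ℝ) ≤ d / 4 * (1 / (d - k)) * (4 * (d - k) / d) := by apply le_of_eq; field_simp
      _ ≤ _ := by
        gcongr
        have : (0 : ℝ) < 1 / k := by positivity
        linarith

/-- The total variation of a function on the cyclic group `ZMod d`. -/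
def cyclicVariation (Ψ : ZMod d → ℂ) : ℝ := ∑ x : ZMod d, ‖Ψ (x + 1) - Ψ x‖

theorem cyclicVariation_nonneg (Ψ : ZMod d → ℂ) : 0 ≤ cyclicVariation Ψ :=
  Finset.sum_nonneg fun _ _ => norm_nonneg _

/-- Cyclic summation by parts: multiplication by `e(m/d) - 1` replaces `Ψ` by its difference
function. -/
theorem norm_dft_mul_le (Ψ : ZMod d → ℂ) (m : ZMod d) :
    ‖ZMod.dft Ψ m‖ * ‖(ZMod.stdAddChar m : ℂ) - 1‖ ≤ cyclicVariation Ψ := by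
  have h : (ZMod.stdAddChar m - 1) * ZMod.dft Ψ m
      = ∑ x : ZMod d, ZMod.stdAddChar (-(x * m)) * (Ψ (x + 1) - Ψ x) := by
    have h1 : ZMod.dft Ψ m = ∑ x : ZMod d, ZMod.stdAddChar (-((x + 1) * m)) * Ψ (x + 1) := by
      rw [ZMod.dft_apply]
      simp only [smul_eq_mul]
      exact (Fintype.sum_equiv (Equiv.addRight (1 : ZMod d)) _ _ fun x => rfl).symm
    have h2 : ZMod.dft Ψ m = ∑ x : ZMod d, ZMod.stdAddChar (-(x * m)) * Ψ x := by
      rw [ZMod.dft_apply]; rfl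
    rw [sub_mul, one_mul]
    conv_lhs => rw [h1, Finset.mul_sum]
    conv_lhs => rw [← h1, h2]
    rw [← Finset.sum_sub_distrib]
    refine Finset.sum_congr rfl fun x _ => ?_
    rw [← mul_assoc, ← AddChar.map_add_eq_mul, mul_sub]
    congr 3
    ring
  rw [mul_comm, ← norm_mul, h]
  refine (norm_sum_le _ _).trans (le_of_eq ?_)
  refine Finset.sum_congr rfl fun x _ => ?_
  rw [norm_mul, AddChar.norm_apply, one_mul]

theorem norm_dft_le (Ψ : ZMod d → ℂ) (m : ZMod d) (hm : m ≠ 0) :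
    ‖ZMod.dft Ψ m‖ ≤ d / 4 * cyclicVariation Ψ * ((1 : ℝ) / m.val + 1 / (d - m.val : ℝ)) := by
  have h1 := le_norm_stdAddChar_sub_one m hm
  have h2 := norm_dft_mul_le Ψ m
  have hmd : (m.val : ℝ) < d := by exact_mod_cast ZMod.val_lt m
  have hpos : 0 ≤ (d : ℝ) / 4 * ((1 : ℝ) / m.val + 1 / (d - m.val : ℝ)) := by
    have : (0 : ℝ) < d - m.val := by linarith
    positivity
  calc ‖ZMod.dft Ψ m‖ = ‖ZMod.dft Ψ m‖ * 1 := (mul_one _).symm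
    _ ≤ ‖ZMod.dft Ψ m‖ * ((d : ℝ) / 4 * ((1 : ℝ) / m.val + 1 / (d - m.val : ℝ)) *
      ‖(ZMod.stdAddChar m : ℂ) - 1‖) := by gcongr
    _ = (d : ℝ) / 4 * ((1 : ℝ) / m.val + 1 / (d - m.val : ℝ)) *
        (‖ZMod.dft Ψ m‖ * ‖(ZMod.stdAddChar m : ℂ) - 1‖) := by ring
    _ ≤ (d : ℝ) / 4 * ((1 : ℝ) / m.val + 1 / (d - m.val : ℝ)) * cyclicVariation Ψ := by gcongr
    _ = _ := by ring

theorem sum_zmod_eq_sum_range (F : ℕ → ℝ) :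
    ∑ x : ZMod d, F x.val = ∑ j ∈ Finset.range d, F j := by
  obtain ⟨n, rfl⟩ : ∃ n, d = n + 1 := ⟨d - 1, by have := NeZero.pos d; omega⟩
  exact Fin.sum_univ_eq_sum_range F (n + 1)

theorem sum_range_gcd_mul_le :
    ∑ j ∈ Finset.range d, (if j = 0 then 0 else (Nat.gcd j d : ℝ) * (1 / j + 1 / (d - j : ℝ)))
      ≤ 2 * (d.divisors.card * (1 + Real.log d)) := by
  have hd : d ≠ 0 := NeZero.ne d
  have h0 : ∑ j ∈ Finset.range d, (if j = 0 then 0 else (Nat.gcd j d : ℝ) * (1 / j + 1 / (d - j : ℝ)))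
      = ∑ j ∈ Finset.Ioo 0 d, (Nat.gcd j d : ℝ) / j +
        ∑ j ∈ Finset.Ioo 0 d, (Nat.gcd j d : ℝ) / ((d - j : ℕ) : ℝ) := by
    rw [← Finset.sum_add_distrib]
    have hs : Finset.Ioo 0 d ⊆ Finset.range d := fun j hj =>
      Finset.mem_range.mpr (Finset.mem_Ioo.mp hj).2
    rw [← Finset.sum_subset hs]
    · refine Finset.sum_congr rfl fun j hj => ?_
      rw [Finset.mem_Ioo] at hj
      rw [if_neg hj.1.ne', Nat.cast_sub hj.2.le]
      ring
    · intro j hj hj'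
      rw [if_pos]
      by_contra h
      exact hj' (Finset.mem_Ioo.mpr ⟨Nat.pos_of_ne_zero h, Finset.mem_range.mp hj⟩)
  -- The reflection `j ↦ d - j` preserves the gcd with `d`.
  have h1 : ∑ j ∈ Finset.Ioo 0 d, (Nat.gcd j d : ℝ) / ((d - j : ℕ) : ℝ)
      = ∑ j ∈ Finset.Ioo 0 d, (Nat.gcd j d : ℝ) / j := by
    refine Finset.sum_nbij' (fun j => d - j) (fun j => d - j) ?_ ?_ ?_ ?_ ?_
    · intro j hj; simp only [Finset.mem_Ioo] at hj ⊢; omega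
    · intro j hj; simp only [Finset.mem_Ioo] at hj ⊢; omega
    · intro j hj; simp only [Finset.mem_Ioo] at hj; omega
    · intro j hj; simp only [Finset.mem_Ioo] at hj; omega
    · intro j hj
      simp only [Finset.mem_Ioo] at hj
      rw [Nat.gcd_self_sub_left hj.2.le]
  have h2 : ∑ j ∈ Finset.Ioo 0 d, (Nat.gcd j d : ℝ) / j
      ≤ ∑ j ∈ Finset.Ioc 0 d, (Nat.gcd j d : ℝ) / j :=
    Finset.sum_le_sum_of_subset_of_nonneg Finset.Ioo_subset_Ioc_self fun _ _ _ => by positivity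
  have h3 := sum_Ioc_gcd_div_le hd
  rw [h0, h1]
  linarith

/-- The gcd weight is the loss in `norm_kloosterman_le`; on average over frequencies it costs only a
divisor factor. -/
theorem sum_gcd_mul_norm_dft_le (Ψ : ZMod d → ℂ) :
    ∑ m ∈ Finset.univ.erase (0 : ZMod d), (Nat.gcd m.val d : ℝ) * ‖ZMod.dft Ψ m‖
      ≤ d * cyclicVariation Ψ * (d.divisors.card * (1 + Real.log d)) := by
  have hV := cyclicVariation_nonneg Ψ
  have h1 : ∑ m ∈ Finset.univ.erase (0 : ZMod d), (Nat.gcd m.val d : ℝ) * ‖ZMod.dft Ψ m‖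
      ≤ d / 4 * cyclicVariation Ψ * ∑ m : ZMod d, (if m.val = 0 then 0 else
        (Nat.gcd m.val d : ℝ) * (1 / m.val + 1 / (d - m.val : ℝ))) := by
    rw [← Finset.add_sum_erase _ _ (Finset.mem_univ (0 : ZMod d)), ZMod.val_zero, if_pos rfl,
      zero_add, Finset.mul_sum]
    refine Finset.sum_le_sum fun m hm => ?_
    have hm0 : m ≠ 0 := (Finset.mem_erase.mp hm).1
    rw [if_neg fun h => hm0 ((ZMod.val_eq_zero m).mp h)]
    calc (Nat.gcd m.val d : ℝ) * ‖ZMod.dft Ψ m‖ ≤ Nat.gcd m.val d *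
          (d / 4 * cyclicVariation Ψ * ((1 : ℝ) / m.val + 1 / (d - m.val : ℝ))) := by
          gcongr
          exact norm_dft_le Ψ m hm0
      _ = _ := by ring
  rw [sum_zmod_eq_sum_range (d := d)
    (fun j => if j = 0 then 0 else (Nat.gcd j d : ℝ) * (1 / j + 1 / (d - j : ℝ)))] at h1
  refine h1.trans ?_
  have hlog : 0 ≤ Real.log d := Real.log_natCast_nonneg d
  calc d / 4 * cyclicVariation Ψ * _
      ≤ d / 4 * cyclicVariation Ψ * (2 * (d.divisors.card * (1 + Real.log d))) := by
        gcongr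
        exact sum_range_gcd_mul_le
    _ ≤ _ := by
        have : 0 ≤ d * cyclicVariation Ψ * (d.divisors.card * (1 + Real.log d)) := by positivity
        linarith

end FourierCoefficients

/-! ### Equidistribution of a unit and its inverse. -/

section Bilinear

variable {d : ℕ} [NeZero d]

theorem apply_eq_sum_dft (Ψ : ZMod d → ℂ) (x : ZMod d) :
    Ψ x = (d : ℂ)⁻¹ * ∑ m : ZMod d, ZMod.stdAddChar (m * x) * ZMod.dft Ψ m := by
  have := congrFun (ZMod.dft.symm_apply_apply Ψ) x
  rw [ZMod.invDFT_apply] at this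
  simpa using this.symm

/-- Fourier inversion in both factors leaves, for each pair of frequencies, the sum over `r` of
`e((nr - mr⁻¹)/d)`. -/
theorem sum_units_eq_sum_kloosterman (Ψ Φ : ZMod d → ℂ) :
    ∑ r : (ZMod d)ˣ, Ψ (-((r⁻¹ : (ZMod d)ˣ) : ZMod d)) * Φ r
      = ((d : ℂ)⁻¹) ^ 2 * ∑ p : ZMod d × ZMod d,
        ZMod.dft Ψ p.1 * ZMod.dft Φ p.2 * kloosterman p.2 (-p.1) := by
  have h : ∀ r : (ZMod d)ˣ, Ψ (-((r⁻¹ : (ZMod d)ˣ) : ZMod d)) * Φ r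
      = ((d : ℂ)⁻¹) ^ 2 * ∑ p : ZMod d × ZMod d, ZMod.dft Ψ p.1 * ZMod.dft Φ p.2 *
        ZMod.stdAddChar (p.2 * (r : ZMod d) + -p.1 * ((r⁻¹ : (ZMod d)ˣ) : ZMod d)) := by
    intro r
    rw [apply_eq_sum_dft Ψ, apply_eq_sum_dft Φ, mul_mul_mul_comm, Finset.sum_mul_sum,
      Fintype.sum_prod_type, sq]
    congr 1
    refine Finset.sum_congr rfl fun m _ => Finset.sum_congr rfl fun n _ => ?_
    rw [AddChar.map_add_eq_mul, mul_neg, neg_mul]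
    ring
  simp only [h, kloosterman, ← Finset.mul_sum]
  rw [Finset.sum_comm]
  simp only [← Finset.mul_sum]

theorem kloosterman_zero_zero : kloosterman (0 : ZMod d) 0 = d.totient := by
  simp [kloosterman, ZMod.card_units_eq_totient]

/-- Joint equidistribution of a unit and its inverse modulo `d`, in terms of variations. -/
theorem norm_sum_units_sub_le (Ψ Φ : ZMod d → ℂ) (B : ℝ) (hΨ : ∀ x, ‖Ψ x‖ ≤ B)
    (hΦ : ∀ x, ‖Φ x‖ ≤ B) (hVΨ : cyclicVariation Ψ ≤ B) (hVΦ : cyclicVariation Φ ≤ B) :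
    ‖∑ r : (ZMod d)ˣ, Ψ (-((r⁻¹ : (ZMod d)ˣ) : ZMod d)) * Φ r
      - d.totient * ((d : ℂ)⁻¹ * ∑ x, Ψ x) * ((d : ℂ)⁻¹ * ∑ x, Φ x)‖
      ≤ 6 * B ^ 2 * (d.divisors.card : ℝ) ^ 3 * (1 + Real.log d) ^ 2 * (d : ℝ) ^ (3 / 4 : ℝ) := by
  have hd : (0 : ℝ) < d := by exact_mod_cast NeZero.pos d
  have hlog : 0 ≤ Real.log d := Real.log_natCast_nonneg d
  have hτ : (1 : ℝ) ≤ d.divisors.card := by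
    exact_mod_cast Finset.card_pos.mpr ⟨1, Nat.one_mem_divisors.mpr (NeZero.ne d)⟩
  have hB : 0 ≤ B := (norm_nonneg _).trans (hΨ 0)
  set τ : ℝ := (d.divisors.card : ℝ)
  set H : ℝ := 1 + Real.log d with hH
  have hH1 : 1 ≤ H := by linarith
  set D : ℝ := (d : ℝ) ^ (3 / 4 : ℝ)
  have h0 : ∀ Θ : ZMod d → ℂ, (∀ x, ‖Θ x‖ ≤ B) → ‖ZMod.dft Θ 0‖ ≤ d * B := by
    intro Θ hΘ
    rw [ZMod.dft_apply_zero]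
    refine (norm_sum_le_of_le _ fun x _ => hΘ x).trans (le_of_eq ?_)
    simp [ZMod.card]
  have hS : ∀ Θ : ZMod d → ℂ, cyclicVariation Θ ≤ B →
      ∑ m ∈ Finset.univ.erase (0 : ZMod d), (Nat.gcd m.val d : ℝ) * ‖ZMod.dft Θ m‖
        ≤ d * B * (τ * H) := by
    intro Θ hΘ
    refine (sum_gcd_mul_norm_dft_le Θ).trans ?_
    gcongr
  have hT : ∑ n : ZMod d, ‖ZMod.dft Φ n‖ ≤ 2 * (d * B * (τ * H)) := by
    rw [← Finset.add_sum_erase _ _ (Finset.mem_univ (0 : ZMod d)), two_mul]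
    refine add_le_add ((h0 Φ hΦ).trans ?_) (le_trans (Finset.sum_le_sum fun m _ => ?_) (hS Φ hVΦ))
    · exact le_mul_of_one_le_right (by positivity) (one_le_mul_of_one_le_of_one_le hτ hH1)
    · refine le_mul_of_one_le_left (norm_nonneg _) ?_
      exact_mod_cast Nat.gcd_pos_of_pos_right _ (NeZero.pos d)
  -- The frequency `(0, 0)` is exactly the mean term. The remaining pairs are split according to `m
  -- = 0` or `m ≠ 0`, so that each has a nonzero frequency carrying the gcd loss.
  have hmain : ∑ r : (ZMod d)ˣ, Ψ (-((r⁻¹ : (ZMod d)ˣ) : ZMod d)) * Φ r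
      - d.totient * ((d : ℂ)⁻¹ * ∑ x, Ψ x) * ((d : ℂ)⁻¹ * ∑ x, Φ x)
      = ((d : ℂ)⁻¹) ^ 2 * (∑ n ∈ Finset.univ.erase (0 : ZMod d),
          ZMod.dft Ψ 0 * ZMod.dft Φ n * kloosterman n 0
        + ∑ m ∈ Finset.univ.erase (0 : ZMod d), ∑ n : ZMod d,
          ZMod.dft Ψ m * ZMod.dft Φ n * kloosterman n (-m)) := by
    rw [sum_units_eq_sum_kloosterman, Fintype.sum_prod_type,
      ← Finset.add_sum_erase _ _ (Finset.mem_univ (0 : ZMod d)),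
      ← Finset.add_sum_erase Finset.univ (fun n : ZMod d => ZMod.dft Ψ ((0 : ZMod d), n).1 *
        ZMod.dft Φ ((0 : ZMod d), n).2 * kloosterman ((0 : ZMod d), n).2 (-((0 : ZMod d), n).1))
        (Finset.mem_univ 0)]
    simp only [neg_zero, kloosterman_zero_zero, ZMod.dft_apply_zero]
    ring
  have hA : ‖∑ n ∈ Finset.univ.erase (0 : ZMod d),
      ZMod.dft Ψ 0 * ZMod.dft Φ n * kloosterman n 0‖ ≤ 2 * τ * D * (d * B) * (d * B * (τ * H)) := by
    refine (norm_sum_le _ _).trans ?_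
    refine le_trans ?_ (mul_le_mul_of_nonneg_left (hS Φ hVΦ) (by positivity))
    rw [Finset.mul_sum]
    refine Finset.sum_le_sum fun n _ => ?_
    rw [norm_mul, norm_mul]
    calc ‖ZMod.dft Ψ 0‖ * ‖ZMod.dft Φ n‖ * ‖kloosterman n 0‖
        ≤ (d * B) * ‖ZMod.dft Φ n‖ * (2 * Nat.gcd n.val d * τ * D) := by
          gcongr
          · exact h0 Ψ hΨ
          · exact norm_kloosterman_le n 0
      _ = _ := by ring
  have hC : ‖∑ m ∈ Finset.univ.erase (0 : ZMod d), ∑ n : ZMod d,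
      ZMod.dft Ψ m * ZMod.dft Φ n * kloosterman n (-m)‖
      ≤ 2 * τ * D * (2 * (d * B * (τ * H))) * (d * B * (τ * H)) := by
    refine (norm_sum_le _ _).trans ?_
    refine le_trans ?_ (mul_le_mul_of_nonneg_left (hS Ψ hVΨ) (by positivity))
    rw [Finset.mul_sum]
    refine Finset.sum_le_sum fun m _ => ?_
    calc ‖∑ n : ZMod d, ZMod.dft Ψ m * ZMod.dft Φ n * kloosterman n (-m)‖
        ≤ ∑ n : ZMod d, (2 * Nat.gcd m.val d * τ * D) * ‖ZMod.dft Ψ m‖ * ‖ZMod.dft Φ n‖ := by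
          refine norm_sum_le_of_le _ fun n _ => ?_
          have hk : ‖kloosterman n (-m)‖ ≤ 2 * Nat.gcd m.val d * τ * D := by
            -- Symmetry moves the gcd loss from `n`, which may vanish, to the nonzero `m`.
            have h1 : kloosterman n (-m) = kloosterman m (-n) := by
              rw [kloosterman_comm]
              unfold kloosterman
              refine Fintype.sum_equiv (Equiv.neg _) _ _ fun x => ?_
              simp [inv_neg]
            rw [h1]
            exact norm_kloosterman_le m (-n)
          rw [norm_mul, norm_mul]
          calc _ ≤ ‖ZMod.dft Ψ m‖ * ‖ZMod.dft Φ n‖ * (2 * Nat.gcd m.val d * τ * D) := by gcongr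
            _ = _ := by ring
      _ = (2 * Nat.gcd m.val d * τ * D) * ‖ZMod.dft Ψ m‖ * ∑ n : ZMod d, ‖ZMod.dft Φ n‖ := by
          rw [Finset.mul_sum]
      _ ≤ (2 * Nat.gcd m.val d * τ * D) * ‖ZMod.dft Ψ m‖ * (2 * (d * B * (τ * H))) := by gcongr
      _ = _ := by ring
  rw [hmain, norm_mul, norm_pow, norm_inv, Complex.norm_natCast]
  have hfin : ((d : ℝ)⁻¹) ^ 2 * (2 * τ * D * (d * B) * (d * B * (τ * H))
      + 2 * τ * D * (2 * (d * B * (τ * H))) * (d * B * (τ * H)))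
      = 2 * B ^ 2 * (τ ^ 2 * H) * D + 4 * B ^ 2 * τ ^ 3 * H ^ 2 * D := by
    field_simp
    ring
  calc _ ≤ ((d : ℝ)⁻¹) ^ 2 * (2 * τ * D * (d * B) * (d * B * (τ * H))
      + 2 * τ * D * (2 * (d * B * (τ * H))) * (d * B * (τ * H))) := by
        gcongr
        exact (norm_add_le _ _).trans (add_le_add hA hC)
    _ = 2 * B ^ 2 * (τ ^ 2 * H) * D + 4 * B ^ 2 * τ ^ 3 * H ^ 2 * D := hfin
    _ ≤ 2 * B ^ 2 * (τ ^ 3 * H ^ 2) * D + 4 * B ^ 2 * τ ^ 3 * H ^ 2 * D := by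
        gcongr
        · norm_num
        · exact le_self_pow₀ hH1 two_ne_zero
    _ = _ := by ring

end Bilinear


/-! ### Lipschitz test functions sampled at fractions. -/

section Sampling

theorem norm_riemann_sum_sub_integral_le {ψ : ℝ → ℂ} {L : ℝ}
    (hL : ∀ x ∈ Icc (0 : ℝ) 1, ∀ y ∈ Icc (0 : ℝ) 1, ‖ψ x - ψ y‖ ≤ L * |x - y|)
    {d : ℕ} (hd : 0 < d) :
    ‖(d : ℂ)⁻¹ * ∑ j ∈ Finset.range d, ψ (j / d) - ∫ x in (0 : ℝ)..1, ψ x‖ ≤ L / d := by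
  have hd' : (0 : ℝ) < d := by exact_mod_cast hd
  have hL0 : 0 ≤ L := by
    have := (norm_nonneg _).trans (hL 0 (by simp) 1 (by simp))
    simpa using this
  have hcont : ContinuousOn ψ (Icc 0 1) := by
    have : LipschitzOnWith (Real.toNNReal L) ψ (Icc 0 1) := by
      refine LipschitzOnWith.of_dist_le_mul fun x hx y hy => ?_
      rw [dist_eq_norm, Real.dist_eq, Real.coe_toNNReal L hL0]
      exact hL x hx y hy
    exact this.continuousOn
  have hmem : ∀ j : ℕ, j ≤ d → (j : ℝ) / d ∈ Icc (0 : ℝ) 1 := fun j hj =>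
    ⟨by positivity, by rw [div_le_one hd']; exact_mod_cast hj⟩
  have hint : ∀ j < d, IntervalIntegrable ψ MeasureTheory.volume ((j : ℝ) / d)
      (((j + 1 : ℕ) : ℝ) / d) := by
    intro j hj
    refine (hcont.mono ?_).intervalIntegrable
    exact (convex_Icc (0 : ℝ) 1).ordConnected.uIcc_subset (hmem j hj.le) (hmem (j + 1) hj)
  have hsum := intervalIntegral.sum_integral_adjacent_intervals hint
  rw [Nat.cast_zero, zero_div, div_self hd'.ne'] at hsum
  rw [← hsum, Finset.mul_sum, ← Finset.sum_sub_distrib]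
  have hterm : ∀ j ∈ Finset.range d, ‖(d : ℂ)⁻¹ * ψ (j / d)
      - ∫ x in ((j : ℝ) / d)..(((j + 1 : ℕ) : ℝ) / d), ψ x‖ ≤ L / d * (1 / d) := by
    intro j hj
    have hj := Finset.mem_range.mp hj
    have hlen : ((j + 1 : ℕ) : ℝ) / d - j / d = 1 / d := by push_cast; ring
    have hle : (j : ℝ) / d ≤ ((j + 1 : ℕ) : ℝ) / d := by
      rw [← sub_nonneg, hlen]; positivity
    have hconst : (d : ℂ)⁻¹ * ψ (j / d)
        = ∫ _ in ((j : ℝ) / d)..(((j + 1 : ℕ) : ℝ) / d), ψ (j / d) := by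
      rw [intervalIntegral.integral_const, hlen]
      simp
    rw [hconst, ← intervalIntegral.integral_sub intervalIntegrable_const (hint j hj)]
    have := intervalIntegral.norm_integral_le_of_norm_le_const
      (a := (j : ℝ) / d) (b := ((j + 1 : ℕ) : ℝ) / d) (C := L / d)
      (f := fun x => ψ (j / d) - ψ x) ?_
    · rwa [hlen, abs_of_pos (by positivity : (0 : ℝ) < 1 / d)] at this
    · intro x hx
      rw [uIoc_of_le hle] at hx
      have hx1 : x ∈ Icc (0 : ℝ) 1 :=
        ⟨(hmem j hj.le).1.trans hx.1.le, hx.2.trans (hmem (j + 1) hj).2⟩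
      refine (hL _ (hmem j hj.le) x hx1).trans ?_
      rw [div_eq_mul_one_div L]
      gcongr
      rw [abs_sub_comm, abs_of_pos (by linarith [hx.1])]
      linarith [hx.2]
  refine (norm_sum_le_of_le _ hterm).trans (le_of_eq ?_)
  rw [Finset.sum_const, Finset.card_range, nsmul_eq_mul]
  field_simp

/-- The sum of `ψ(c / d) H(r / d)` over the units `r` modulo `d`, where `c = -r⁻¹`. -/
def unitSum (d : ℕ) [NeZero d] (ψ H : ℝ → ℂ) : ℂ :=
  ∑ r : (ZMod d)ˣ, ψ ((-((r⁻¹ : (ZMod d)ˣ) : ZMod d)).val / d) * H ((r : ZMod d).val / d)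

theorem zmod_val_div_mem (d : ℕ) [NeZero d] (x : ZMod d) :
    ((x.val : ℝ) / d) ∈ Icc (0 : ℝ) 1 := by
  have hd : (0 : ℝ) < d := by exact_mod_cast NeZero.pos d
  exact ⟨by positivity, by rw [div_le_one hd]; exact_mod_cast (ZMod.val_lt x).le⟩

theorem cyclicVariation_sample_le {ψ : ℝ → ℂ} {B L : ℝ}
    (hB : ∀ x ∈ Icc (0 : ℝ) 1, ‖ψ x‖ ≤ B)
    (hL : ∀ x ∈ Icc (0 : ℝ) 1, ∀ y ∈ Icc (0 : ℝ) 1, ‖ψ x - ψ y‖ ≤ L * |x - y|)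
    (d : ℕ) [NeZero d] :
    cyclicVariation (fun x : ZMod d => ψ (x.val / d)) ≤ L + 2 * B := by
  have hd : (0 : ℝ) < d := by exact_mod_cast NeZero.pos d
  have hB0 : 0 ≤ B := (norm_nonneg _).trans (hB 0 (by simp))
  have hL0 : 0 ≤ L := by
    have := (norm_nonneg _).trans (hL 0 (by simp) 1 (by simp))
    simpa using this
  -- Only the step from `d - 1` back to `0` is not of length `1/d`; it costs at most `2B` because
  -- `ψ` need not be periodic.
  have h : ∀ x : ZMod d, ‖ψ ((x + 1).val / d) - ψ (x.val / d)‖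
      ≤ L / d + if x = -1 then 2 * B else 0 := by
    intro x
    split_ifs with hx
    · have h1 := hB _ (zmod_val_div_mem d (x + 1))
      have h2 := hB _ (zmod_val_div_mem d x)
      have h3 := norm_sub_le (ψ ((x + 1).val / d)) (ψ (x.val / d))
      have : 0 ≤ L / d := by positivity
      linarith
    · have hval : (x + 1).val = x.val + 1 := by
        have h1 : (x + 1 : ZMod d) = ((x.val + 1 : ℕ) : ZMod d) := by
          rw [Nat.cast_add, ZMod.natCast_zmod_val, Nat.cast_one]
        rw [h1]
        refine ZMod.val_cast_of_lt ?_
        refine lt_of_le_of_ne (ZMod.val_lt x) fun h2 => hx ?_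
        rw [h2, ZMod.natCast_self] at h1
        exact eq_neg_of_add_eq_zero_left h1
      refine (hL _ (zmod_val_div_mem d (x + 1)) _ (zmod_val_div_mem d x)).trans (le_of_eq ?_)
      rw [hval, add_zero, ← sub_div]
      push_cast
      rw [add_sub_cancel_left, abs_of_pos (by positivity), mul_one_div]
  refine (Finset.sum_le_sum fun x _ => h x).trans (le_of_eq ?_)
  rw [Finset.sum_add_distrib, Finset.sum_const, Finset.card_univ, ZMod.card, nsmul_eq_mul,
    mul_div_cancel₀ _ hd.ne', Finset.sum_ite_eq' Finset.univ]
  simp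

theorem exists_card_divisors_pow_mul_log_le :
    ∃ C : ℝ, 0 < C ∧ ∀ d : ℕ, d ≠ 0 →
      (d.divisors.card : ℝ) ^ 3 * (1 + Real.log d) ^ 2 * (d : ℝ) ^ (3 / 4 : ℝ)
        ≤ C * (d : ℝ) ^ (5 / 6 : ℝ) := by
  -- The exponents balance as `3/72 + 2/48 + 3/4 = 5/6`.
  obtain ⟨C, hC, h⟩ := exists_card_divisors_le_rpow (ε := 1 / 72) (by norm_num)
  refine ⟨C ^ 3 * 49 ^ 2, by positivity, fun d hd => ?_⟩
  have hd1 : (1 : ℝ) ≤ d := by exact_mod_cast Nat.one_le_iff_ne_zero.mpr hd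
  have hd0 : (0 : ℝ) < d := by linarith
  have hlog0 : 0 ≤ Real.log d := Real.log_natCast_nonneg d
  have hlog : 1 + Real.log d ≤ 49 * (d : ℝ) ^ (1 / 48 : ℝ) := by
    have h1 := Real.log_le_rpow_div hd0.le (ε := 1 / 48) (by norm_num)
    have h2 : 1 ≤ (d : ℝ) ^ (1 / 48 : ℝ) := Real.one_le_rpow hd1 (by norm_num)
    linarith
  calc _ ≤ (C * (d : ℝ) ^ (1 / 72 : ℝ)) ^ 3 * (49 * (d : ℝ) ^ (1 / 48 : ℝ)) ^ 2
        * (d : ℝ) ^ (3 / 4 : ℝ) := by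
        gcongr
        exact h d hd
    _ = C ^ 3 * 49 ^ 2 * (((d : ℝ) ^ (1 / 72 : ℝ)) ^ 3 * ((d : ℝ) ^ (1 / 48 : ℝ)) ^ 2
        * (d : ℝ) ^ (3 / 4 : ℝ)) := by ring
    _ = _ := by
        congr 1
        rw [← Real.rpow_natCast, ← Real.rpow_natCast, ← Real.rpow_mul hd0.le,
          ← Real.rpow_mul hd0.le, ← Real.rpow_add hd0, ← Real.rpow_add hd0]
        norm_num

/-- Joint equidistribution of `-r⁻¹ / d` and `r / d` for bounded Lipschitz functions, with a
power saving that is uniform in the functions. -/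
theorem exists_norm_unitSum_sub_le :
    ∃ C : ℝ, 0 < C ∧ ∀ (ψ H : ℝ → ℂ) (B L : ℝ),
      (∀ x ∈ Icc (0 : ℝ) 1, ‖ψ x‖ ≤ B) → (∀ x ∈ Icc (0 : ℝ) 1, ‖H x‖ ≤ B) →
      (∀ x ∈ Icc (0 : ℝ) 1, ∀ y ∈ Icc (0 : ℝ) 1, ‖ψ x - ψ y‖ ≤ L * |x - y|) →
      (∀ x ∈ Icc (0 : ℝ) 1, ∀ y ∈ Icc (0 : ℝ) 1, ‖H x - H y‖ ≤ L * |x - y|) →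
      ∀ (d : ℕ) [NeZero d],
      ‖unitSum d ψ H - d.totient * ((∫ x in (0 : ℝ)..1, ψ x) * ∫ x in (0 : ℝ)..1, H x)‖
        ≤ C * (L + 2 * B) ^ 2 * (d : ℝ) ^ (5 / 6 : ℝ) := by
  obtain ⟨C, hC, hdiv⟩ := exists_card_divisors_pow_mul_log_le
  refine ⟨6 * C + 1, by positivity, fun ψ H B L hψ hH hψL hHL d _ => ?_⟩
  have hd0 : (0 : ℝ) < d := by exact_mod_cast NeZero.pos d
  have hd1 : (1 : ℝ) ≤ d := by exact_mod_cast NeZero.pos d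
  have hB0 : 0 ≤ B := (norm_nonneg _).trans (hψ 0 (by simp))
  have hL0 : 0 ≤ L := by
    have := (norm_nonneg _).trans (hψL 0 (by simp) 1 (by simp))
    simpa using this
  set M := L + 2 * B with hM
  have hBM : B ≤ M := by linarith
  have h1 := norm_sum_units_sub_le (d := d) (fun x => ψ (x.val / d)) (fun x => H (x.val / d)) M
    (fun x => (hψ _ (zmod_val_div_mem d x)).trans hBM)
    (fun x => (hH _ (zmod_val_div_mem d x)).trans hBM)
    (cyclicVariation_sample_le hψ hψL d) (cyclicVariation_sample_le hH hHL d)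
  have hr : ∀ F : ℕ → ℂ, ∑ x : ZMod d, F x.val = ∑ j ∈ Finset.range d, F j := by
    intro F
    obtain ⟨n, rfl⟩ : ∃ n, d = n + 1 := ⟨d - 1, by have := NeZero.pos d; omega⟩
    exact Fin.sum_univ_eq_sum_range F (n + 1)
  rw [hr fun j => ψ (j / d), hr fun j => H (j / d)] at h1
  have h2 := norm_riemann_sum_sub_integral_le hψL (NeZero.pos d)
  have h3 := norm_riemann_sum_sub_integral_le hHL (NeZero.pos d)
  have h4 : ∀ F : ℝ → ℂ, (∀ x ∈ Icc (0 : ℝ) 1, ‖F x‖ ≤ B) →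
      ‖(d : ℂ)⁻¹ * ∑ j ∈ Finset.range d, F (j / d)‖ ≤ B := by
    intro F hF
    rw [norm_mul, norm_inv, Complex.norm_natCast, inv_mul_le_iff₀ hd0]
    refine (norm_sum_le_of_le (Finset.range d) (f := fun j => F (j / d)) (n := fun _ => B)
      fun j hj => hF _ ⟨by positivity, ?_⟩).trans ?_
    · rw [div_le_one hd0]; exact_mod_cast (Finset.mem_range.mp hj).le
    · rw [Finset.sum_const, Finset.card_range, nsmul_eq_mul]
  have h5 : ‖∫ x in (0 : ℝ)..1, H x‖ ≤ B := by
    have := intervalIntegral.norm_integral_le_of_norm_le_const (a := (0 : ℝ)) (b := 1) (C := B)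
      (f := H) fun x hx => hH x (by
        rw [uIoc_of_le zero_le_one] at hx
        exact ⟨hx.1.le, hx.2⟩)
    simpa using this
  have h4' := h4 ψ hψ
  set mψ := (d : ℂ)⁻¹ * ∑ j ∈ Finset.range d, ψ (j / d)
  set mH := (d : ℂ)⁻¹ * ∑ j ∈ Finset.range d, H (j / d)
  set iψ := ∫ x in (0 : ℝ)..1, ψ x
  set iH := ∫ x in (0 : ℝ)..1, H x
  -- Replacing Riemann sums by integrals costs `O(1/d)`, which the factor `φ(d) ≤ d` turns into a
  -- constant.
  have h6 : ‖(d.totient : ℂ) * (mψ * mH - iψ * iH)‖ ≤ M ^ 2 := by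
    rw [norm_mul, Complex.norm_natCast]
    have h7 : ‖mψ * mH - iψ * iH‖ ≤ M ^ 2 / d := by
      have : mψ * mH - iψ * iH = mψ * (mH - iH) + (mψ - iψ) * iH := by ring
      rw [this]
      refine (norm_add_le _ _).trans ?_
      rw [norm_mul mψ, norm_mul (mψ - iψ)]
      calc ‖mψ‖ * ‖mH - iH‖ + ‖mψ - iψ‖ * ‖iH‖ ≤ B * (L / d) + (L / d) * B := by gcongr
        _ = (2 * B * L) / d := by ring
        _ ≤ _ := by
          gcongr
          nlinarith
    calc (d.totient : ℝ) * ‖mψ * mH - iψ * iH‖ ≤ d * (M ^ 2 / d) := by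
          gcongr
          exact Nat.totient_le d
      _ = M ^ 2 := by field_simp
  have h8 : unitSum d ψ H - d.totient * (iψ * iH)
      = (unitSum d ψ H - d.totient * mψ * mH) + d.totient * (mψ * mH - iψ * iH) := by ring
  rw [h8]
  refine (norm_add_le _ _).trans ?_
  have h9 : 1 ≤ (d : ℝ) ^ (5 / 6 : ℝ) := Real.one_le_rpow hd1 (by norm_num)
  have h10 := hdiv d (NeZero.ne d)
  calc ‖unitSum d ψ H - d.totient * mψ * mH‖ + ‖(d.totient : ℂ) * (mψ * mH - iψ * iH)‖
      ≤ 6 * M ^ 2 * (d.divisors.card : ℝ) ^ 3 * (1 + Real.log d) ^ 2 * (d : ℝ) ^ (3 / 4 : ℝ)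
        + M ^ 2 := add_le_add h1 h6
    _ = 6 * M ^ 2 * ((d.divisors.card : ℝ) ^ 3 * (1 + Real.log d) ^ 2 * (d : ℝ) ^ (3 / 4 : ℝ))
        + M ^ 2 * 1 := by ring
    _ ≤ 6 * M ^ 2 * (C * (d : ℝ) ^ (5 / 6 : ℝ)) + M ^ 2 * (d : ℝ) ^ (5 / 6 : ℝ) := by gcongr
    _ = _ := by ring

end Sampling

/-! ### Dirichlet series of discrepancies, holomorphic in the parameter. -/

section AnalyticFamilies

/-- A family of functions on `[0, 1]`, holomorphic in the parameter `s ∈ Ω`, bounded by `B` and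
Lipschitz with constant `L` uniformly in `s`. -/
structure LipschitzFamily (Ω : Set ℂ) (ψ : ℂ → ℝ → ℂ) (B L : ℝ) : Prop where
  differentiableOn : ∀ x ∈ Icc (0 : ℝ) 1, DifferentiableOn ℂ (fun s => ψ s x) Ω
  norm_le : ∀ s ∈ Ω, ∀ x ∈ Icc (0 : ℝ) 1, ‖ψ s x‖ ≤ B
  lipschitz : ∀ s ∈ Ω, ∀ x ∈ Icc (0 : ℝ) 1, ∀ y ∈ Icc (0 : ℝ) 1,
    ‖ψ s x - ψ s y‖ ≤ L * |x - y|

variable {Ω : Set ℂ} {ψ H : ℂ → ℝ → ℂ} {B L B' L' : ℝ}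

theorem LipschitzFamily.mono (h : LipschitzFamily Ω ψ B L) (hB : B ≤ B') (hL : L ≤ L') :
    LipschitzFamily Ω ψ B' L' where
  differentiableOn := h.differentiableOn
  norm_le s hs x hx := (h.norm_le s hs x hx).trans hB
  lipschitz s hs x hx y hy := (h.lipschitz s hs x hx y hy).trans (by gcongr)

/-- The uniform Lipschitz constant makes the Riemann sums converge uniformly in `s`, so holomorphy
passes to the limit. -/
theorem LipschitzFamily.differentiableOn_integral (hΩ : IsOpen Ω)
    (h : LipschitzFamily Ω ψ B L) :
    DifferentiableOn ℂ (fun s => ∫ x in (0 : ℝ)..1, ψ s x) Ω := by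
  have hunif : TendstoUniformlyOn
      (fun (n : ℕ) s => ((n + 1 : ℕ) : ℂ)⁻¹ * ∑ j ∈ Finset.range (n + 1),
        ψ s (j / ((n + 1 : ℕ) : ℝ))) (fun s => ∫ x in (0 : ℝ)..1, ψ s x) atTop Ω := by
    rw [Metric.tendstoUniformlyOn_iff]
    intro ε hε
    have hlim : Tendsto (fun n : ℕ => L / ((n + 1 : ℕ) : ℝ)) atTop (𝓝 0) := by
      have := (tendsto_const_div_atTop_nhds_zero_nat L).comp (tendsto_add_atTop_nat 1)
      exact this
    filter_upwards [hlim.eventually_lt_const hε] with n hn s hs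
    rw [dist_comm, dist_eq_norm]
    exact (norm_riemann_sum_sub_integral_le (h.lipschitz s hs) n.succ_pos).trans_lt hn
  refine hunif.tendstoLocallyUniformlyOn.differentiableOn (Eventually.of_forall fun n => ?_) hΩ
  refine DifferentiableOn.const_mul (DifferentiableOn.fun_sum fun j hj => ?_) _
  refine h.differentiableOn _ ⟨by positivity, ?_⟩
  rw [div_le_one (by positivity)]
  exact_mod_cast (Finset.mem_range.mp hj).le

theorem differentiable_natCast_succ_cpow (n : ℕ) (a : ℂ) :
    Differentiable ℂ fun s : ℂ => ((n + 1 : ℕ) : ℂ) ^ (a * s) := by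
  refine Differentiable.const_cpow (by fun_prop) (Or.inl ?_)
  exact_mod_cast n.succ_ne_zero

theorem norm_natCast_succ_cpow (n : ℕ) (s : ℂ) :
    ‖((n + 1 : ℕ) : ℂ) ^ s‖ = ((n + 1 : ℕ) : ℝ) ^ s.re :=
  Complex.norm_natCast_cpow_of_pos n.succ_pos s

theorem summable_natCast_succ_rpow {p : ℝ} (hp : p < -1) :
    Summable fun n : ℕ => ((n + 1 : ℕ) : ℝ) ^ p :=
  (summable_nat_add_iff 1).mpr (Real.summable_nat_rpow.mpr hp)

/-- The discrepancy between the unit sum and its mean. -/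
def unitDiscrepancy (ψ H : ℂ → ℝ → ℂ) (n : ℕ) (s : ℂ) : ℂ :=
  unitSum (n + 1) (ψ s) (H s)
    - ((n + 1).totient : ℂ) * ((∫ x in (0 : ℝ)..1, ψ s x) * ∫ x in (0 : ℝ)..1, H s x)

theorem LipschitzFamily.differentiableOn_unitDiscrepancy (hΩ : IsOpen Ω)
    (hψ : LipschitzFamily Ω ψ B L) (hH : LipschitzFamily Ω H B L) (n : ℕ) :
    DifferentiableOn ℂ (unitDiscrepancy ψ H n) Ω := by
  refine DifferentiableOn.sub (DifferentiableOn.fun_sum fun r _ => ?_) ?_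
  · exact (hψ.differentiableOn _ (zmod_val_div_mem _ _)).mul
      (hH.differentiableOn _ (zmod_val_div_mem _ _))
  · exact ((hψ.differentiableOn_integral hΩ).mul (hH.differentiableOn_integral hΩ)).const_mul _

/-- The abscissa `11/18` is where `-3σ + 5/6 = -1`. -/
theorem LipschitzFamily.exists_summable_bound {σ₀ : ℝ} (hσ : 11 / 18 < σ₀)
    (hΩσ : ∀ s ∈ Ω, σ₀ ≤ s.re)
    (hψ : LipschitzFamily Ω ψ B L) (hH : LipschitzFamily Ω H B L) :
    ∃ u : ℕ → ℝ, Summable u ∧ ∀ n, ∀ s ∈ Ω,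
      ‖((n + 1 : ℕ) : ℂ) ^ (-3 * s) * unitDiscrepancy ψ H n s‖ ≤ u n := by
  obtain ⟨C, hC, hbound⟩ := exists_norm_unitSum_sub_le
  refine ⟨fun n => C * (L + 2 * B) ^ 2 * ((n + 1 : ℕ) : ℝ) ^ (-3 * σ₀ + 5 / 6),
    (summable_natCast_succ_rpow (by linarith)).mul_left _, fun n s hs => ?_⟩
  have h := hbound (ψ s) (H s) B L (hψ.norm_le s hs) (hH.norm_le s hs) (hψ.lipschitz s hs)
    (hH.lipschitz s hs) (n + 1)
  have hn : (1 : ℝ) ≤ ((n + 1 : ℕ) : ℝ) := by exact_mod_cast n.succ_pos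
  rw [norm_mul, norm_natCast_succ_cpow]
  calc _ ≤ ((n + 1 : ℕ) : ℝ) ^ (-3 * σ₀) * (C * (L + 2 * B) ^ 2 * ((n + 1 : ℕ) : ℝ) ^ (5 / 6 : ℝ)) := by
        gcongr
        · have := hΩσ s hs
          simp
          linarith
        · exact h
    _ = _ := by
        simp only
        rw [Real.rpow_add (by positivity)]
        ring

theorem LipschitzFamily.differentiableOn_tsum (hΩ : IsOpen Ω) {σ₀ : ℝ} (hσ : 11 / 18 < σ₀)
    (hΩσ : ∀ s ∈ Ω, σ₀ ≤ s.re)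
    (hψ : LipschitzFamily Ω ψ B L) (hH : LipschitzFamily Ω H B L) :
    DifferentiableOn ℂ
      (fun s => ∑' n : ℕ, ((n + 1 : ℕ) : ℂ) ^ (-3 * s) * unitDiscrepancy ψ H n s) Ω := by
  obtain ⟨u, hu, hbound⟩ := hψ.exists_summable_bound hσ hΩσ hH
  exact Complex.differentiableOn_tsum_of_summable_norm hu
    (fun n => (differentiable_natCast_succ_cpow n (-3)).differentiableOn.mul
      (hψ.differentiableOn_unitDiscrepancy hΩ hH n)) hΩ hbound

theorem LipschitzFamily.summable_unitDiscrepancy {σ₀ : ℝ} (hσ : 11 / 18 < σ₀)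
    (hΩσ : ∀ s ∈ Ω, σ₀ ≤ s.re) (hψ : LipschitzFamily Ω ψ B L) (hH : LipschitzFamily Ω H B L)
    {s : ℂ} (hs : s ∈ Ω) :
    Summable fun n : ℕ => ((n + 1 : ℕ) : ℂ) ^ (-3 * s) * unitDiscrepancy ψ H n s := by
  obtain ⟨u, hu, hbound⟩ := hψ.exists_summable_bound hσ hΩσ hH
  exact Summable.of_norm_bounded hu fun n => hbound n s hs

end AnalyticFamilies


/-! ### The two concrete families: `exp(s l)` and the periodized kernel. -/

section ExponentialFamilies

theorem norm_exp_mul_ofReal (s : ℂ) (t : ℝ) : ‖Complex.exp (s * t)‖ = Real.exp (s.re * t) := by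
  rw [Complex.norm_exp, Complex.re_mul_ofReal]

/-- Mean value inequality along the segment. The convex set is left free because a bounded interval
serves for `l`, while a half-line is needed to keep the decay of the kernel. -/
theorem norm_exp_mul_sub_exp_mul_le (s : ℂ) {S : Set ℝ} (hS : Convex ℝ S) {c : ℝ}
    (hc : ∀ t ∈ S, s.re * t ≤ c) {α β : ℝ} (hα : α ∈ S) (hβ : β ∈ S) :
    ‖Complex.exp (s * α) - Complex.exp (s * β)‖ ≤ ‖s‖ * Real.exp c * |α - β| := by
  have hderiv : ∀ t ∈ S, HasDerivWithinAt (fun t : ℝ => Complex.exp (s * t))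
      (Complex.exp (s * t) * s) S t := by
    intro t _
    have h1 : HasDerivAt (fun t : ℝ => s * (t : ℂ)) s t := by
      simpa using (Complex.ofRealCLM.hasDerivAt (x := t)).const_mul s
    exact h1.cexp.hasDerivWithinAt
  refine hS.norm_image_sub_le_of_norm_hasDerivWithin_le hderiv (fun t ht => ?_) hβ hα
  rw [norm_mul, norm_exp_mul_ofReal, mul_comm]
  gcongr
  exact hc t ht

/-- The bounded part of the half-plane `σ₀ < Re s`. -/
def truncatedHalfPlane (σ₀ R : ℝ) : Set ℂ := {s | σ₀ < s.re ∧ ‖s‖ < R}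

theorem isOpen_truncatedHalfPlane (σ₀ R : ℝ) : IsOpen (truncatedHalfPlane σ₀ R) :=
  (isOpen_lt continuous_const Complex.continuous_re).inter
    (isOpen_lt continuous_norm continuous_const)

theorem lipschitzFamily_exp {l : ℝ → ℝ} {b Λ σ₀ R : ℝ} (hb : ∀ x ∈ Icc (0 : ℝ) 1, |l x| ≤ b)
    (hΛ : ∀ x ∈ Icc (0 : ℝ) 1, ∀ y ∈ Icc (0 : ℝ) 1, |l x - l y| ≤ Λ * |x - y|) :
    LipschitzFamily (truncatedHalfPlane σ₀ R) (fun s x => Complex.exp (s * l x))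
      (Real.exp (R * b)) (R * Real.exp (R * b) * Λ) := by
  have hre : ∀ s ∈ truncatedHalfPlane σ₀ R, ∀ t : ℝ, |t| ≤ b → s.re * t ≤ R * b := by
    intro s hs t ht
    calc s.re * t ≤ |s.re * t| := le_abs_self _
      _ = |s.re| * |t| := abs_mul _ _
      _ ≤ R * b := by
        gcongr
        · exact (norm_nonneg s).trans hs.2.le
        · exact (Complex.abs_re_le_norm s).trans hs.2.le
  refine ⟨fun x _ => by fun_prop, fun s hs x hx => ?_, fun s hs x hx y hy => ?_⟩
  · rw [norm_exp_mul_ofReal]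
    exact Real.exp_le_exp.mpr (hre s hs _ (hb x hx))
  · have h := norm_exp_mul_sub_exp_mul_le s (convex_Icc (-b) b)
      (fun t ht => hre s hs t (abs_le.mpr ht)) (abs_le.mp (hb x hx)) (abs_le.mp (hb y hy))
    refine h.trans ?_
    rw [mul_assoc (R * _)]
    exact mul_le_mul (mul_le_mul_of_nonneg_right hs.2.le (Real.exp_pos _).le) (hΛ x hx y hy)
      (abs_nonneg _) (mul_nonneg ((norm_nonneg s).trans hs.2.le) (Real.exp_pos _).le)

theorem abs_log_sub_log_le {x y : ℝ} (hx : 1 ≤ x) (hy : 1 ≤ y) :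
    |Real.log x - Real.log y| ≤ |x - y| := by
  have key : ∀ a b : ℝ, 1 ≤ a → 1 ≤ b → Real.log a - Real.log b ≤ |a - b| := by
    intro a b ha hb
    have hb0 : 0 < b := by linarith
    rw [← Real.log_div (by linarith) hb0.ne']
    refine (Real.log_le_sub_one_of_pos (by positivity)).trans ?_
    have : a / b - 1 = (a - b) / b := by field_simp
    rw [this]
    refine (div_le_div_of_nonneg_right (le_abs_self (a - b)) hb0.le).trans ?_
    exact div_le_self (abs_nonneg _) hb
  refine abs_le.mpr ⟨?_, key x y hx hy⟩
  have := key y x hy hx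
  rw [abs_sub_comm] at this
  linarith

/-- The logarithm of `(x + k + 1) (x + k + 2)`. -/
def logKernel (k : ℕ) (x : ℝ) : ℝ := Real.log ((x + k + 1) * (x + k + 2))

theorem logKernel_ge {k : ℕ} {x : ℝ} (hx : x ∈ Icc (0 : ℝ) 1) :
    2 * Real.log ((k + 1 : ℕ) : ℝ) ≤ logKernel k x := by
  have hk : (0 : ℝ) ≤ k := k.cast_nonneg
  rw [logKernel, two_mul, ← Real.log_mul (by positivity) (by positivity)]
  refine Real.log_le_log (by positivity) ?_
  push_cast
  gcongr <;> linarith [hx.1]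

theorem abs_logKernel_sub_le {k : ℕ} {x y : ℝ} (hx : x ∈ Icc (0 : ℝ) 1)
    (hy : y ∈ Icc (0 : ℝ) 1) : |logKernel k x - logKernel k y| ≤ 2 * |x - y| := by
  have hk : (0 : ℝ) ≤ k := k.cast_nonneg
  have hx0 := hx.1
  have hy0 := hy.1
  rw [logKernel, logKernel, Real.log_mul (by positivity) (by positivity),
    Real.log_mul (by positivity) (by positivity)]
  have h1 := abs_log_sub_log_le (x := x + k + 1) (y := y + k + 1) (by linarith) (by linarith)
  have h2 := abs_log_sub_log_le (x := x + k + 2) (y := y + k + 2) (by linarith) (by linarith)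
  have e1 : x + k + 1 - (y + k + 1) = x - y := by ring
  have e2 : x + k + 2 - (y + k + 2) = x - y := by ring
  rw [e1] at h1
  rw [e2] at h2
  have h3 : Real.log (x + k + 1) + Real.log (x + k + 2)
      - (Real.log (y + k + 1) + Real.log (y + k + 2))
      = (Real.log (x + k + 1) - Real.log (y + k + 1))
        + (Real.log (x + k + 2) - Real.log (y + k + 2)) := by ring
  rw [h3]
  exact (abs_add_le _ _).trans (by linarith)

theorem exp_neg_mul_logKernel_le {σ₀ σ : ℝ} (h0 : 0 ≤ σ₀) (hσ : σ₀ ≤ σ) (k : ℕ) {t : ℝ}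
    (ht : 2 * Real.log ((k + 1 : ℕ) : ℝ) ≤ t) :
    Real.exp (-σ * t) ≤ ((k + 1 : ℕ) : ℝ) ^ (-2 * σ₀) := by
  have hlog : 0 ≤ Real.log ((k + 1 : ℕ) : ℝ) := Real.log_natCast_nonneg _
  rw [Real.rpow_def_of_pos (by positivity)]
  refine Real.exp_le_exp.mpr ?_
  nlinarith

/-- The periodization `∑ₖ ((x + k + 1) (x + k + 2)) ^ (-s)`. -/
def kernelSum (s : ℂ) (x : ℝ) : ℂ := ∑' k : ℕ, Complex.exp (-s * logKernel k x)

theorem norm_exp_neg_mul_logKernel_le {σ₀ : ℝ} (h0 : 0 ≤ σ₀) {s : ℂ} (hs : σ₀ ≤ s.re) (k : ℕ)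
    {x : ℝ} (hx : x ∈ Icc (0 : ℝ) 1) :
    ‖Complex.exp (-s * logKernel k x)‖ ≤ ((k + 1 : ℕ) : ℝ) ^ (-2 * σ₀) := by
  rw [norm_exp_mul_ofReal, Complex.neg_re]
  exact exp_neg_mul_logKernel_le h0 hs k (logKernel_ge hx)

theorem summable_kernelSum {s : ℂ} (hs : 1 / 2 < s.re) {x : ℝ} (hx : x ∈ Icc (0 : ℝ) 1) :
    Summable fun k : ℕ => Complex.exp (-s * logKernel k x) :=
  Summable.of_norm_bounded (summable_natCast_succ_rpow (p := -2 * s.re) (by linarith))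
    fun k => norm_exp_neg_mul_logKernel_le (by linarith) le_rfl k hx

theorem lipschitzFamily_kernelSum {σ₀ R : ℝ} (hσ₀ : 1 / 2 < σ₀) :
    LipschitzFamily (truncatedHalfPlane σ₀ R) kernelSum
      (∑' k : ℕ, ((k + 1 : ℕ) : ℝ) ^ (-2 * σ₀))
      (2 * R * ∑' k : ℕ, ((k + 1 : ℕ) : ℝ) ^ (-2 * σ₀)) := by
  have hsum := summable_natCast_succ_rpow (p := -2 * σ₀) (by linarith)
  have h0 : 0 ≤ σ₀ := by linarith
  refine ⟨fun x hx => ?_, fun s hs x hx => ?_, fun s hs x hx y hy => ?_⟩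
  · exact Complex.differentiableOn_tsum_of_summable_norm hsum (fun k => by fun_prop)
      (isOpen_truncatedHalfPlane σ₀ R)
      (fun k s hs => norm_exp_neg_mul_logKernel_le h0 hs.1.le k hx)
  · exact tsum_of_norm_bounded hsum.hasSum
      fun k => norm_exp_neg_mul_logKernel_le h0 hs.1.le k hx
  · have hs' : 1 / 2 < s.re := hσ₀.trans hs.1
    rw [kernelSum, kernelSum, ← (summable_kernelSum hs' hx).tsum_sub (summable_kernelSum hs' hy)]
    refine tsum_of_norm_bounded (g := fun k : ℕ => 2 * R * |x - y| * ((k + 1 : ℕ) : ℝ) ^ (-2 * σ₀))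
      ?_ fun k => ?_
    · convert! hsum.hasSum.mul_left (2 * R * |x - y|) using 1
      ring
    -- On this half-line the exponential is at most `(k+1)^(-2σ₀)`, so the difference of two kernel
    -- terms is as summable as the terms themselves.
    · have hmem : ∀ t ∈ Ici (2 * Real.log ((k + 1 : ℕ) : ℝ)),
          (-s).re * t ≤ Real.log (((k + 1 : ℕ) : ℝ) ^ (-2 * σ₀)) := by
        intro t ht
        rw [Real.le_log_iff_exp_le (by positivity), Complex.neg_re]
        exact exp_neg_mul_logKernel_le h0 hs.1.le k ht
      have h := norm_exp_mul_sub_exp_mul_le (-s) (convex_Ici _) hmem (logKernel_ge hx)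
        (logKernel_ge hy)
      rw [norm_neg, Real.exp_log (by positivity)] at h
      refine h.trans ?_
      calc ‖s‖ * ((k + 1 : ℕ) : ℝ) ^ (-2 * σ₀) * |logKernel k x - logKernel k y|
          ≤ R * ((k + 1 : ℕ) : ℝ) ^ (-2 * σ₀) * (2 * |x - y|) := by
            have hR : 0 ≤ R := (norm_nonneg s).trans hs.2.le
            have := abs_logKernel_sub_le (k := k) hx hy
            have := hs.2.le
            gcongr
        _ = _ := by ring

end ExponentialFamilies

/-! ### The Dirichlet series of Euler's function. -/

section TotientSeries

open LSeries.notation in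
-- The identity `∑_{g ∣ n} φ(g) = n` reads `ζ(w) ∑ φ(n) n^(-w) = ζ(w - 1)`.
theorem hasSum_totient_cpow {w : ℂ} (hw : 2 < w.re) :
    HasSum (fun n : ℕ => ((n + 1).totient : ℂ) * ((n + 1 : ℕ) : ℂ) ^ (-w))
      (riemannZeta (w - 1) / riemannZeta w) := by
  have hw1 : 1 < w.re := by linarith
  have hid : ∀ f : ℕ → ℂ, (∀ n, ‖f n‖ ≤ n) → LSeriesSummable f w := fun f hf =>
    LSeriesSummable_of_le_const_mul_rpow hw ⟨1, fun n _ => by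
      have : (2 : ℝ) - 1 = 1 := by norm_num
      rw [this, Real.rpow_one, one_mul]
      exact hf n⟩
  have hφ : LSeriesSummable (fun n => (n.totient : ℂ)) w := hid _ fun n => by
    rw [Complex.norm_natCast]; exact_mod_cast Nat.totient_le n
  have h1 : LSeriesSummable (1 : ℕ → ℂ) w := LSeriesSummable_one_iff.mpr hw1
  have hconv : LSeries (fun n => (n : ℂ)) w = LSeries (1 : ℕ → ℂ) w *
      LSeries (fun n => (n.totient : ℂ)) w := by
    rw [← LSeries_convolution' h1 hφ]
    refine LSeries_congr (fun {n} hn => ?_) w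
    rw [LSeries.convolution_def]
    simp only [Pi.one_apply, one_mul]
    rw [Nat.sum_divisorsAntidiagonal' (fun _ j => (j.totient : ℂ))]
    exact_mod_cast (Nat.sum_totient n).symm
  have hshift : LSeries (fun n => (n : ℂ)) w = LSeries (1 : ℕ → ℂ) (w - 1) := by
    refine tsum_congr fun n => ?_
    rcases eq_or_ne n 0 with rfl | hn
    · simp
    · have hn' : (n : ℂ) ≠ 0 := Nat.cast_ne_zero.mpr hn
      rw [LSeries.term_of_ne_zero hn, LSeries.term_of_ne_zero hn, Complex.cpow_sub _ _ hn',
        Complex.cpow_one, Pi.one_apply, one_div_div]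
  have hζ : riemannZeta w ≠ 0 := riemannZeta_ne_zero_of_one_lt_re hw1
  rw [hshift, LSeries_one_eq_riemannZeta hw1,
    LSeries_one_eq_riemannZeta (by simp; linarith)] at hconv
  rw [hconv, mul_div_cancel_left₀ _ hζ]
  have hs := hφ.LSeriesHasSum
  rw [LSeriesHasSum, ← hasSum_nat_add_iff' 1] at hs
  simp only [Finset.range_one, Finset.sum_singleton, LSeries.term_zero, sub_zero] at hs
  refine hs.congr_fun fun n => ?_
  rw [LSeries.term_of_ne_zero n.succ_ne_zero, Complex.cpow_neg, div_eq_mul_inv]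

end TotientSeries

/-! ### The kernel mean at `2/3` as a Beta integral. -/

section BetaValue

/-- The integrand `(t (1 - t)) ^ (-2/3)` of the Beta integral. -/
def betaIntegrand (t : ℝ) : ℝ := (t * (1 - t)) ^ (-(2 / 3) : ℝ)

theorem ofReal_betaIntegrand {t : ℝ} (ht : t ∈ Icc (0 : ℝ) 1) :
    ((betaIntegrand t : ℝ) : ℂ)
      = (t : ℂ) ^ ((1 / 3 : ℂ) - 1) * (1 - (t : ℂ)) ^ ((1 / 3 : ℂ) - 1) := by
  have h1 : 0 ≤ 1 - t := sub_nonneg.mpr ht.2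
  rw [betaIntegrand, Real.mul_rpow ht.1 h1, Complex.ofReal_mul, Complex.ofReal_cpow ht.1,
    Complex.ofReal_cpow h1]
  push_cast
  norm_num

theorem intervalIntegrable_betaIntegrand :
    IntervalIntegrable betaIntegrand MeasureTheory.volume 0 1 := by
  have h := Complex.betaIntegral_convergent (u := 1 / 3) (v := 1 / 3) (by norm_num) (by norm_num)
  have h2 : IntervalIntegrable (fun t => ((betaIntegrand t : ℝ) : ℂ)) MeasureTheory.volume 0 1 :=
    h.congr (fun t ht => by
      rw [uIoc_of_le zero_le_one] at ht
      exact (ofReal_betaIntegrand ⟨ht.1.le, ht.2⟩).symm)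
  rw [intervalIntegrable_iff] at h2 ⊢
  exact h2.re

/-- This is `Γ(1/3)² / Γ(2/3)`, and the reflection formula `Γ(1/3) Γ(2/3) = 2π/√3` removes `Γ(2/3)`.
-/
theorem integral_betaIntegrand :
    ∫ t in (0 : ℝ)..1, betaIntegrand t
      = Real.sqrt 3 * Real.Gamma (1 / 3) ^ 3 / (2 * Real.pi) := by
  have h : ((∫ t in (0 : ℝ)..1, betaIntegrand t : ℝ) : ℂ)
      = Complex.betaIntegral ((1 / 3 : ℝ) : ℂ) ((1 / 3 : ℝ) : ℂ) := by
    rw [← intervalIntegral.integral_ofReal, Complex.betaIntegral]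
    refine intervalIntegral.integral_congr fun t ht => ?_
    rw [uIcc_of_le zero_le_one] at ht
    have := ofReal_betaIntegrand ht
    push_cast
    exact this
  have h2 := ProbabilityTheory.beta_eq_betaIntegralReal (1 / 3) (1 / 3) (by norm_num) (by norm_num)
  rw [← h, Complex.ofReal_re, ProbabilityTheory.beta] at h2
  rw [← h2]
  have h3 := Real.Gamma_mul_Gamma_one_sub (1 / 3)
  have h4 : Real.sin (Real.pi * (1 / 3)) = Real.sqrt 3 / 2 := by
    rw [← Real.sin_pi_div_three]; congr 1; ring
  rw [h4] at h3
  have e1 : (1 : ℝ) - 1 / 3 = 1 / 3 + 1 / 3 := by norm_num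
  rw [e1] at h3
  have hG : 0 < Real.Gamma (1 / 3) := Real.Gamma_pos_of_pos (by norm_num)
  have hG2 : 0 < Real.Gamma (1 / 3 + 1 / 3) := Real.Gamma_pos_of_pos (by norm_num)
  have h5 : 0 < Real.sqrt 3 := Real.sqrt_pos.mpr (by norm_num)
  have hπ := Real.pi_pos
  rw [div_eq_div_iff hG2.ne' (by positivity)]
  have h6 : Real.Gamma (1 / 3) * Real.Gamma (1 / 3 + 1 / 3) * Real.sqrt 3 = 2 * Real.pi := by
    rw [h3]; field_simp
  linear_combination (-Real.Gamma (1 / 3) ^ 2) * h6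

theorem integral_betaIntegrand_half :
    ∫ t in (0 : ℝ)..(1 / 2), betaIntegrand t
      = Real.sqrt 3 * Real.Gamma (1 / 3) ^ 3 / (4 * Real.pi) := by
  have hi := intervalIntegrable_betaIntegrand
  have hsub1 : uIcc (0 : ℝ) (1 / 2) ⊆ uIcc 0 1 := by
    rw [uIcc_of_le (by norm_num), uIcc_of_le (by norm_num)]
    exact Icc_subset_Icc le_rfl (by norm_num)
  have hsub2 : uIcc (1 / 2 : ℝ) 1 ⊆ uIcc 0 1 := by
    rw [uIcc_of_le (by norm_num), uIcc_of_le (by norm_num)]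
    exact Icc_subset_Icc (by norm_num) le_rfl
  have h1 := intervalIntegral.integral_add_adjacent_intervals (hi.mono_set hsub1)
    (hi.mono_set hsub2)
  have h2 : ∫ t in (1 / 2 : ℝ)..1, betaIntegrand t = ∫ t in (0 : ℝ)..(1 / 2), betaIntegrand t := by
    have := intervalIntegral.integral_comp_sub_left betaIntegrand (a := 1 / 2) (b := 1) 1
    rw [show (1 : ℝ) - 1 = 0 by norm_num, show (1 : ℝ) - 1 / 2 = 1 / 2 by norm_num] at this
    rw [← this]
    refine intervalIntegral.integral_congr fun t _ => ?_
    simp only [betaIntegrand]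
    congr 1
    ring
  rw [h2, integral_betaIntegrand] at h1
  have hπ := Real.pi_pos
  field_simp at h1 ⊢
  linarith

/-- Substitute `t = 1/(1+y)`: then `t(1-t) = y/(1+y)²` and `|dt| = dy/(1+y)²`. -/
theorem integral_rpow_eq_integral_betaIntegrand (n : ℕ) :
    ∫ y in (1 : ℝ)..(n + 1), (y * (y + 1)) ^ (-(2 / 3) : ℝ)
      = ∫ t in (1 / ((n : ℝ) + 2))..(1 / 2), betaIntegrand t := by
  have hn : (0 : ℝ) ≤ n := n.cast_nonneg
  have hle : (1 : ℝ) ≤ n + 1 := by linarith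
  have hpos : ∀ x ∈ uIcc (1 : ℝ) (n + 1), 0 < x := by
    intro x hx
    rw [uIcc_of_le hle] at hx
    linarith [hx.1]
  have h := intervalIntegral.integral_comp_mul_deriv' (a := 1) (b := n + 1)
    (f := fun y : ℝ => 1 / (1 + y)) (f' := fun y => -(1 / (1 + y) ^ 2)) (g := betaIntegrand)
    (fun x hx => by
      have hx0 := hpos x hx
      have := ((hasDerivAt_id x).const_add 1).inv (by simp; linarith)
      simp only [id, one_div] at this ⊢
      convert! this using 1
      field_simp)
    (by
      refine ContinuousOn.neg (ContinuousOn.div continuousOn_const (by fun_prop) fun x hx => ?_)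
      have := hpos x hx
      positivity)
    (by
      refine ContinuousOn.rpow_const (by fun_prop) ?_
      rintro _ ⟨x, hx, rfl⟩
      left
      have hx0 := hpos x hx
      have : 1 - 1 / (1 + x) = x / (1 + x) := by field_simp; ring
      simp only
      rw [this]
      positivity)
  have e1 : (1 : ℝ) / (1 + 1) = 1 / 2 := by norm_num
  have e2 : (1 : ℝ) / (1 + (n + 1)) = 1 / (n + 2) := by congr 1; ring
  simp only [e1, e2] at h
  rw [intervalIntegral.integral_symm (1 / 2 : ℝ), ← h, ← intervalIntegral.integral_neg]
  refine intervalIntegral.integral_congr fun x hx => ?_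
  have hx0 := hpos x hx
  have e3 : 1 / (1 + x) * (1 - 1 / (1 + x)) = x * (x + 1) * ((1 + x) ^ 3)⁻¹ := by
    field_simp; ring
  simp only [Function.comp_apply, betaIntegrand]
  have e4 : (((1 + x) ^ 3)⁻¹) ^ (-(2 / 3) : ℝ) = (1 + x) ^ 2 := by
    rw [← Real.rpow_natCast, ← Real.rpow_neg (by positivity), ← Real.rpow_mul (by positivity),
      ← Real.rpow_natCast]
    norm_num
  rw [e3, Real.mul_rpow (x := x * (x + 1)) (by positivity) (by positivity), e4]
  field_simp

theorem exp_neg_mul_logKernel (k : ℕ) {x : ℝ} (hx : 0 ≤ x) :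
    Complex.exp (-(2 / 3 : ℂ) * logKernel k x)
      = (((x + (k + 1)) * (x + (k + 1) + 1)) ^ (-(2 / 3) : ℝ) : ℝ) := by
  have hk : (0 : ℝ) ≤ k := k.cast_nonneg
  rw [Real.rpow_def_of_pos (by positivity), logKernel]
  push_cast
  congr 1
  have : (x + k + 1) * (x + k + 2) = (x + (k + 1)) * (x + (k + 1) + 1) := by ring
  rw [this]
  ring

/-- Unfolding: the `k`-th term integrated over `[0, 1]` is the integral of `(y(y+1))^(-2/3)` over
`[k+1, k+2]`, so the partial sums telescope to an integral from `1`. -/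
theorem integral_kernelSum_two_thirds :
    ∫ x in (0 : ℝ)..1, kernelSum (2 / 3) x
      = (Real.sqrt 3 * Real.Gamma (1 / 3) ^ 3 / (4 * Real.pi) : ℝ) := by
  have hmem : ∀ t : ℝ, t ∈ uIoc (0 : ℝ) 1 → t ∈ Icc (0 : ℝ) 1 := fun t ht => by
    rw [uIoc_of_le zero_le_one] at ht
    exact ⟨ht.1.le, ht.2⟩
  have hre : ((2 / 3 : ℂ)).re = 2 / 3 := by norm_num
  have hbsum := summable_natCast_succ_rpow (p := -2 * (2 / 3)) (by norm_num)
  have hHas := intervalIntegral.hasSum_integral_of_dominated_convergence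
    (a := (0 : ℝ)) (b := 1) (μ := MeasureTheory.volume)
    (F := fun (k : ℕ) (x : ℝ) => Complex.exp (-(2 / 3 : ℂ) * logKernel k x))
    (f := kernelSum (2 / 3)) (fun k _ => ((k + 1 : ℕ) : ℝ) ^ (-2 * (2 / 3) : ℝ))
    (fun k => by
      refine Measurable.aestronglyMeasurable ?_
      unfold logKernel
      fun_prop)
    (fun k => Eventually.of_forall fun t ht =>
      norm_exp_neg_mul_logKernel_le (by norm_num) hre.ge k (hmem t ht))
    (Eventually.of_forall fun _ _ => hbsum)
    intervalIntegrable_const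
    (Eventually.of_forall fun t ht =>
      (summable_kernelSum (by rw [hre]; norm_num) (hmem t ht)).hasSum)
  have hpart : ∀ n : ℕ, ∑ k ∈ Finset.range n,
      ∫ x in (0 : ℝ)..1, Complex.exp (-(2 / 3 : ℂ) * logKernel k x)
      = ((∫ t in (1 / ((n : ℝ) + 2))..(1 / 2), betaIntegrand t : ℝ) : ℂ) := by
    intro n
    have hk : ∀ k : ℕ, ∫ x in (0 : ℝ)..1, Complex.exp (-(2 / 3 : ℂ) * logKernel k x)
        = ((∫ y in ((k : ℕ) + 1 : ℝ)..((k + 1 : ℕ) + 1 : ℝ),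
          (y * (y + 1)) ^ (-(2 / 3) : ℝ) : ℝ) : ℂ) := by
      intro k
      have := intervalIntegral.integral_comp_add_right (a := 0) (b := 1)
        (fun y : ℝ => (y * (y + 1)) ^ (-(2 / 3) : ℝ)) ((k : ℝ) + 1)
      rw [show (0 : ℝ) + (k + 1) = (k : ℕ) + 1 by ring,
        show (1 : ℝ) + (k + 1) = ((k + 1 : ℕ) : ℝ) + 1 by push_cast; ring] at this
      rw [← this, ← intervalIntegral.integral_ofReal]
      refine intervalIntegral.integral_congr fun x hx => ?_
      rw [uIcc_of_le zero_le_one] at hx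
      exact exp_neg_mul_logKernel k hx.1
    simp only [hk]
    rw [← Complex.ofReal_sum, ← integral_rpow_eq_integral_betaIntegrand]
    congr 1
    have := intervalIntegral.sum_integral_adjacent_intervals (n := n)
      (a := fun k : ℕ => (k : ℝ) + 1) (f := fun y : ℝ => (y * (y + 1)) ^ (-(2 / 3) : ℝ))
      (μ := MeasureTheory.volume) (fun k _ => by
        refine ContinuousOn.intervalIntegrable ?_
        refine ContinuousOn.rpow_const (by fun_prop) fun x hx => Or.inl ?_
        have hk0 : (0 : ℝ) ≤ k := k.cast_nonneg
        rw [uIcc_of_le (by push_cast; linarith)] at hx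
        have : 0 < x := by linarith [hx.1]
        positivity)
    simpa using this
  have hlim1 := hHas.tendsto_sum_nat
  simp only [hpart] at hlim1
  -- The integrand blows up at `0` but is integrable, so its primitive is continuous up to `0`.
  have hcont : ContinuousOn (fun x => ∫ t in x..(1 / 2 : ℝ), betaIntegrand t)
      (uIcc 0 (1 / 2)) := by
    refine intervalIntegral.continuousOn_primitive_interval_left ?_
    have hsub : uIcc (0 : ℝ) (1 / 2) ⊆ uIcc 0 1 := by
      rw [uIcc_of_le (by norm_num), uIcc_of_le (by norm_num)]
      exact Icc_subset_Icc le_rfl (by norm_num)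
    exact ((intervalIntegrable_iff_integrableOn_Icc_of_le (by norm_num)).mp
      (intervalIntegrable_betaIntegrand)).mono_set (by rwa [uIcc_of_le (zero_le_one' ℝ)] at hsub)
  have hseq : Tendsto (fun n : ℕ => 1 / ((n : ℝ) + 2)) atTop (𝓝[uIcc 0 (1 / 2)] 0) := by
    refine tendsto_nhdsWithin_iff.mpr ⟨?_, Eventually.of_forall fun n => ?_⟩
    · have := (tendsto_const_div_atTop_nhds_zero_nat (1 : ℝ)).comp (tendsto_add_atTop_nat 2)
      refine this.congr fun n => ?_
      simp
    · rw [uIcc_of_le (by norm_num)]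
      exact ⟨by positivity, by gcongr; linarith [(n.cast_nonneg : (0 : ℝ) ≤ n)]⟩
  have hlim2 := (hcont 0 left_mem_uIcc).tendsto.comp hseq
  have hlim3 := (Complex.continuous_ofReal.tendsto _).comp hlim2
  rw [← integral_betaIntegrand_half]
  exact tendsto_nhds_unique hlim1 hlim3

end BetaValue


/-! ### Parametrization of Farey intervals. -/

namespace FareyInterval

theorem eq_of_fields {I I' : FareyInterval} (ha : I.a = I'.a) (hb : I.b = I'.b)
    (hc : I.c = I'.c) (hd : I.d = I'.d) : I = I' := by
  cases I; cases I'
  simp only at ha hb hc hd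
  subst ha hb hc hd
  rfl

theorem c_lt (I : FareyInterval) : I.c < I.d := by
  refine lt_of_le_of_ne I.c_le fun h => ?_
  have h1 := I.det_eq
  have h2 := I.a_le
  have h3 : (0 : ℤ) < I.d := by exact_mod_cast I.d_pos
  rw [h] at h1
  nlinarith

/-- A Farey interval is determined by its pair of denominators. -/
theorem denominators_injective :
    Function.Injective fun I : FareyInterval => (I.b, I.d) := by
  intro I I' h
  simp only [Prod.mk.injEq] at h
  obtain ⟨hb, hd⟩ := h
  have h1 := I.det_eq
  have h2 := I'.det_eq
  rw [← hb, ← hd] at h2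
  -- The determinant fixes `bc` modulo `d` and `b` is invertible there; as `0 ≤ c < d`, the residue
  -- determines `c`.
  have hdvd : (I.d : ℤ) ∣ I.c - I'.c := by
    have hcop : IsCoprime (I.d : ℤ) (I.b : ℤ) := ⟨I.a, -I.c, by linear_combination h1⟩
    refine hcop.dvd_of_dvd_mul_left ⟨I.a - I'.a, by linear_combination h2 - h1⟩
  have hc : I.c = I'.c := by
    have hlt := I.c_lt
    have hlt' := I'.c_lt
    rw [← hd] at hlt'
    have h0 := I.c_nonneg
    have h0' := I'.c_nonneg
    have := Int.eq_zero_of_abs_lt_dvd hdvd (abs_lt.mpr ⟨by linarith, by linarith⟩)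
    linarith
  have ha : I.a = I'.a := by
    have h3 : (I.a - I'.a) * (I.d : ℤ) = 0 := by
      rw [← hc] at h2
      linear_combination h1 - h2
    have h4 : (I.d : ℤ) ≠ 0 := by exact_mod_cast I.d_pos.ne'
    rcases mul_eq_zero.mp h3 with h5 | h5
    · linarith
    · exact absurd h5 h4
  exact eq_of_fields ha hb hc hd

theorem b_cast_pos (I : FareyInterval) : (0 : ℝ) < I.b := Nat.cast_pos.mpr I.b_pos

theorem d_cast_pos (I : FareyInterval) : (0 : ℝ) < I.d := Nat.cast_pos.mpr I.d_pos

theorem length_eq (I : FareyInterval) :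
    (I.a : ℝ) / I.b - (I.c : ℝ) / I.d = 1 / (I.b * I.d) := by
  have hb := I.b_cast_pos
  have hd := I.d_cast_pos
  have h : (I.a : ℝ) * I.d - I.b * I.c = 1 := by exact_mod_cast I.det_eq
  field_simp
  linarith

theorem left_nonneg (I : FareyInterval) : (0 : ℝ) ≤ (I.c : ℝ) / I.d :=
  div_nonneg (by exact_mod_cast I.c_nonneg) I.d_cast_pos.le

theorem right_le_one (I : FareyInterval) : (I.a : ℝ) / I.b ≤ 1 := by
  rw [div_le_one I.b_cast_pos]
  exact_mod_cast I.a_le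

theorem left_le_right (I : FareyInterval) : (I.c : ℝ) / I.d ≤ (I.a : ℝ) / I.b := by
  have h := I.length_eq
  have hb := I.b_cast_pos
  have hd := I.d_cast_pos
  have : (0 : ℝ) ≤ 1 / (I.b * I.d) := by positivity
  linarith

theorem Icc_subset (I : FareyInterval) :
    Icc ((I.c : ℝ) / I.d) ((I.a : ℝ) / I.b) ⊆ Icc 0 1 :=
  Icc_subset_Icc I.left_nonneg I.right_le_one

/-- The logarithm of `b d (b + d)`. -/
def logSize (I : FareyInterval) : ℝ := Real.log (I.b * I.d * (I.b + I.d))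

/-- Since `b + d` exceeds both `b` and `d`, it exceeds `√(bd)`. This exponent `3/2` produces the
abscissa `2/3`. -/
theorem logSize_ge (I : FareyInterval) :
    3 / 2 * (Real.log I.b + Real.log I.d) ≤ I.logSize := by
  have hb := I.b_cast_pos
  have hd := I.d_cast_pos
  rw [logSize, Real.log_mul (by positivity) (by positivity), Real.log_mul hb.ne' hd.ne']
  have h1 : Real.log I.b ≤ Real.log (I.b + I.d) := Real.log_le_log hb (by linarith)
  have h2 : Real.log I.d ≤ Real.log (I.b + I.d) := Real.log_le_log hd (by linarith)
  linarith

theorem exp_neg_mul_logSize_le (I : FareyInterval) {q σ : ℝ} (hq : 0 ≤ q) (hσ : 2 / 3 * q ≤ σ) :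
    Real.exp (-σ * I.logSize) ≤ (I.b : ℝ) ^ (-q) * (I.d : ℝ) ^ (-q) := by
  have hb := I.b_cast_pos
  have hd := I.d_cast_pos
  rw [Real.rpow_def_of_pos hb, Real.rpow_def_of_pos hd, ← Real.exp_add]
  refine Real.exp_le_exp.mpr ?_
  have h := I.logSize_ge
  have h1 : 0 ≤ Real.log I.b := Real.log_natCast_nonneg _
  have h2 : 0 ≤ Real.log I.d := Real.log_natCast_nonneg _
  nlinarith

theorem summable_denominators_rpow {q : ℝ} (hq : 1 < q) :
    Summable fun I : FareyInterval => (I.b : ℝ) ^ (-q) * (I.d : ℝ) ^ (-q) := by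
  have h1 : Summable fun n : ℕ => (n : ℝ) ^ (-q) := Real.summable_nat_rpow.mpr (by linarith)
  have h2 : Summable fun p : ℕ × ℕ => (p.1 : ℝ) ^ (-q) * (p.2 : ℝ) ^ (-q) :=
    h1.mul_of_nonneg h1 (fun _ => by positivity) (fun _ => by positivity)
  have h3 := h2.comp_injective (i := fun I : FareyInterval => (I.b, I.d)) denominators_injective
  simpa only [Function.comp_def] using h3

/-- The reflection `x ↦ 1 - x` of Farey intervals. -/
def reflect (I : FareyInterval) : FareyInterval where
  a := I.d - I.c
  b := I.d
  c := I.b - I.a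
  d := I.b
  b_pos := I.d_pos
  d_pos := I.b_pos
  c_nonneg := sub_nonneg.mpr I.a_le
  c_le := by linarith [I.a_nonneg]
  a_nonneg := sub_nonneg.mpr I.c_le
  a_le := by linarith [I.c_nonneg]
  gcd_ab := Int.isCoprime_iff_gcd_eq_one.mp ⟨I.b, I.a - I.b, by linear_combination I.det_eq⟩
  gcd_cd := Int.isCoprime_iff_gcd_eq_one.mp ⟨-I.d, I.d - I.c, by linear_combination I.det_eq⟩
  det_eq := by linear_combination I.det_eq

theorem reflect_reflect (I : FareyInterval) : I.reflect.reflect = I :=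
  eq_of_fields (sub_sub_cancel _ _) rfl (sub_sub_cancel _ _) rfl

theorem logSize_reflect (I : FareyInterval) : I.reflect.logSize = I.logSize := by
  simp only [logSize, reflect]
  congr 1
  ring

/-- The Farey intervals whose left endpoint has the smaller denominator. -/
def leftHeavy : Set FareyInterval := {I | I.d ≤ I.b}

/-- Reflection exchanges the conditions `d ≤ b` and `b ≤ d`. -/
def reflectEquiv : leftHeavy ≃ {I : FareyInterval | I.b ≤ I.d} where
  toFun I := ⟨I.1.reflect, I.2⟩
  invFun I := ⟨I.1.reflect, I.2⟩
  left_inv I := Subtype.ext I.1.reflect_reflect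
  right_inv I := Subtype.ext I.1.reflect_reflect

/-- The Farey interval `[0, 1]`. -/
def unitInterval : FareyInterval where
  a := 1
  b := 1
  c := 0
  d := 1
  b_pos := one_pos
  d_pos := one_pos
  c_nonneg := le_rfl
  c_le := by norm_num
  a_nonneg := by norm_num
  a_le := by norm_num
  gcd_ab := by norm_num
  gcd_cd := by norm_num
  det_eq := by norm_num

theorem eq_unitInterval (I : FareyInterval) (h : I.b = I.d) : I = unitInterval := by
  have h1 := I.det_eq
  have h2 : I.d = 1 := by
    have : (I.d : ℤ) ∣ 1 := ⟨I.a - I.c, by rw [h] at h1; linear_combination -h1⟩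
    exact Nat.dvd_one.mp (by exact_mod_cast this)
  exact denominators_injective (Prod.ext (h.trans h2) h2)

/-- The Farey interval with denominators `b`, `d` and left numerator `c`. -/
def ofDvd (b c d : ℕ) (hb : 0 < b) (hc : c < d) (h : (d : ℤ) ∣ 1 + b * c) : FareyInterval where
  a := (1 + b * c) / d
  b := b
  c := c
  d := d
  b_pos := hb
  d_pos := by omega
  c_nonneg := Int.natCast_nonneg _
  c_le := by exact_mod_cast hc.le
  a_nonneg := by positivity
  a_le := by
    have hc' : (c : ℤ) + 1 ≤ d := by exact_mod_cast hc
    have hb' : (1 : ℤ) ≤ b := by exact_mod_cast hb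
    refine Int.le_of_mul_le_mul_right (a := (d : ℤ)) ?_ (by linarith [Int.natCast_nonneg c])
    rw [Int.ediv_mul_cancel h]
    nlinarith
  gcd_ab := Int.isCoprime_iff_gcd_eq_one.mp
    ⟨d, -c, by linear_combination Int.ediv_mul_cancel h⟩
  gcd_cd := Int.isCoprime_iff_gcd_eq_one.mp
    ⟨-b, (1 + b * c) / d, by linear_combination Int.ediv_mul_cancel h⟩
  det_eq := by linear_combination Int.ediv_mul_cancel h

theorem dvd_one_add_mul_val (n : ℕ) (r : (ZMod (n + 1))ˣ) (k : ℕ) :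
    ((n + 1 : ℕ) : ℤ) ∣ 1 + (((r : ZMod (n + 1)).val + (k + 1) * (n + 1) : ℕ) : ℤ) *
      (((-((r⁻¹ : (ZMod (n + 1))ˣ) : ZMod (n + 1))).val : ℕ) : ℤ) := by
  rw [← ZMod.intCast_zmod_eq_zero_iff_dvd]
  have h0 : ((n : ZMod (n + 1)) + 1) = 0 := by
    have := ZMod.natCast_self (n + 1)
    exact_mod_cast this
  push_cast
  rw [ZMod.natCast_zmod_val, ZMod.natCast_zmod_val, h0, mul_zero, add_zero, mul_neg,
    Units.mul_inv, add_neg_cancel]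

/-- The Farey interval with denominators `d = n + 1` and `b = r + (k + 1) d`. -/
def ofUnit (n : ℕ) (r : (ZMod (n + 1))ˣ) (k : ℕ) : FareyInterval :=
  ofDvd ((r : ZMod (n + 1)).val + (k + 1) * (n + 1))
    (-((r⁻¹ : (ZMod (n + 1))ˣ) : ZMod (n + 1))).val (n + 1) (by positivity) (ZMod.val_lt _)
    (dvd_one_add_mul_val n r k)

theorem ofUnit_mem_leftHeavy (n : ℕ) (r : (ZMod (n + 1))ˣ) (k : ℕ) :
    ofUnit n r k ∈ leftHeavy := by
  change n + 1 ≤ (r : ZMod (n + 1)).val + (k + 1) * (n + 1)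
  nlinarith [Nat.zero_le ((r : ZMod (n + 1)).val), Nat.zero_le (k * (n + 1))]

/-- Euclidean division of `b` by `d`: the remainder is a unit because `b` and `d` are coprime, and
the quotient is at least `1` because `d ≤ b`, hence `k + 1`. For `d = 1` the only unit has
representative `0`. -/
theorem ofUnit_bijective : Function.Bijective
    fun p : Σ n : ℕ, (ZMod (n + 1))ˣ × ℕ =>
      (⟨ofUnit p.1 p.2.1 p.2.2, ofUnit_mem_leftHeavy _ _ _⟩ : leftHeavy) := by
  constructor
  · rintro ⟨n, r, k⟩ ⟨n', r', k'⟩ h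
    have h1 := congrArg Subtype.val h
    have hd : n + 1 = n' + 1 := congrArg FareyInterval.d h1
    obtain rfl : n = n' := Nat.succ.inj hd
    have hb : (r : ZMod (n + 1)).val + (k + 1) * (n + 1)
        = (r' : ZMod (n + 1)).val + (k' + 1) * (n + 1) := congrArg FareyInterval.b h1
    have hr : (r : ZMod (n + 1)).val = (r' : ZMod (n + 1)).val := by
      have := congrArg (· % (n + 1)) hb
      simpa [Nat.add_mul_mod_self_right, Nat.mod_eq_of_lt (ZMod.val_lt _)] using this
    have hk : k = k' := by
      rw [hr] at hb
      have := Nat.eq_of_mul_eq_mul_right n.succ_pos (Nat.add_left_cancel hb)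
      omega
    obtain rfl : r = r' := Units.ext (ZMod.val_injective _ hr)
    rw [hk]
  · rintro ⟨I, hI⟩
    have hI' : I.d ≤ I.b := hI
    obtain ⟨n, hn⟩ : ∃ n, I.d = n + 1 := ⟨I.d - 1, by have := I.d_pos; omega⟩
    have hcop : Nat.Coprime I.b (n + 1) := by
      rw [← hn]
      refine Nat.isCoprime_iff_coprime.mp ⟨-I.c, I.a, by linear_combination I.det_eq⟩
    refine ⟨⟨n, ZMod.unitOfCoprime I.b hcop, I.b / (n + 1) - 1⟩, Subtype.ext ?_⟩
    refine denominators_injective (Prod.ext ?_ hn.symm)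
    change (ZMod.unitOfCoprime I.b hcop : ZMod (n + 1)).val
      + (I.b / (n + 1) - 1 + 1) * (n + 1) = I.b
    rw [ZMod.coe_unitOfCoprime, ZMod.val_natCast]
    have hpos : 0 < I.b / (n + 1) := Nat.div_pos (hn ▸ hI') n.succ_pos
    rw [Nat.sub_add_cancel hpos, mul_comm]
    exact Nat.mod_add_div _ _

theorem logSize_ofUnit (n : ℕ) (r : (ZMod (n + 1))ˣ) (k : ℕ) :
    (ofUnit n r k).logSize = 3 * Real.log ((n + 1 : ℕ) : ℝ)
      + logKernel k ((r : ZMod (n + 1)).val / ((n + 1 : ℕ) : ℝ)) := by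
  set d : ℝ := ((n + 1 : ℕ) : ℝ) with hd
  have hd0 : 0 < d := by positivity
  set v : ℝ := ((r : ZMod (n + 1)).val : ℝ)
  have hv : 0 ≤ v := by positivity
  have hb : ((ofUnit n r k).b : ℝ) = d * (v / d + k + 1) := by
    have : (ofUnit n r k).b = (r : ZMod (n + 1)).val + (k + 1) * (n + 1) := rfl
    rw [this]
    field_simp
    push_cast [hd]
    ring
  have hd' : ((ofUnit n r k).d : ℝ) = d := rfl
  have h3 : d * (v / d + k + 1) * d * (d * (v / d + k + 1) + d)
      = d ^ 3 * ((v / d + k + 1) * (v / d + k + 2)) := by ring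
  rw [logSize, logKernel, hb, hd', h3, Real.log_mul (by positivity) (by positivity), Real.log_pow]
  norm_num

end FareyInterval


/-! ### The half series over `d ≤ b`. -/

section FareySeries

/-- The term `exp (s l(ξ_I)) (b d (b + d)) ^ (-s)` attached to sample points `ξ`. -/
def sampledTerm (l : ℝ → ℝ) (ξ : FareyInterval → ℝ) (s : ℂ) (I : FareyInterval) : ℂ :=
  Complex.exp (s * l (ξ I)) * Complex.exp (-s * I.logSize)

/-- The left endpoint of a Farey interval. -/
def FareyInterval.left (I : FareyInterval) : ℝ := (I.c : ℝ) / I.d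

variable {l : ℝ → ℝ} {b Λ : ℝ} {ξ : FareyInterval → ℝ}

theorem differentiable_sampledTerm (I : FareyInterval) :
    Differentiable ℂ fun s => sampledTerm l ξ s I := by
  unfold sampledTerm
  fun_prop

theorem norm_exp_mul_le_of_abs_le {s : ℂ} {t : ℝ} (ht : |t| ≤ b) :
    ‖Complex.exp (s * t)‖ ≤ Real.exp (‖s‖ * b) := by
  rw [norm_exp_mul_ofReal]
  refine Real.exp_le_exp.mpr ?_
  calc s.re * t ≤ |s.re * t| := le_abs_self _
    _ = |s.re| * |t| := abs_mul _ _
    _ ≤ ‖s‖ * b := by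
      gcongr
      exact Complex.abs_re_le_norm s

theorem summable_sampledTerm (hb : ∀ x ∈ Icc (0 : ℝ) 1, |l x| ≤ b)
    (hξ : ∀ I, ξ I ∈ Icc (0 : ℝ) 1) {s : ℂ} (hs : 2 / 3 < s.re) :
    Summable (sampledTerm l ξ s) := by
  refine Summable.of_norm_bounded ((FareyInterval.summable_denominators_rpow
    (q := 3 / 2 * s.re) (by linarith)).mul_left (Real.exp (‖s‖ * b))) fun I => ?_
  rw [sampledTerm, norm_mul]
  refine mul_le_mul (norm_exp_mul_le_of_abs_le (hb _ (hξ I))) ?_ (norm_nonneg _)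
    (Real.exp_pos _).le
  rw [norm_exp_mul_ofReal, Complex.neg_re]
  exact I.exp_neg_mul_logSize_le (by linarith) (by linarith)

/-- The interval has length `1/(bd)` and the size factor is at most `(bd)^(-3/4)` once `Re s ≥ 1/2`,
which together give the summable `(bd)^(-7/4)`. -/
theorem norm_sampledTerm_sub_le {R : ℝ} (hb : ∀ x ∈ Icc (0 : ℝ) 1, |l x| ≤ b)
    (hΛ : ∀ x ∈ Icc (0 : ℝ) 1, ∀ y ∈ Icc (0 : ℝ) 1, |l x - l y| ≤ Λ * |x - y|)
    (hξ : ∀ I : FareyInterval, ξ I ∈ Icc ((I.c : ℝ) / I.d) ((I.a : ℝ) / I.b))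
    {σ₀ : ℝ} (hσ₀ : 1 / 2 ≤ σ₀) {s : ℂ} (hs : s ∈ truncatedHalfPlane σ₀ R) (I : FareyInterval) :
    ‖sampledTerm l ξ s I - sampledTerm l FareyInterval.left s I‖
      ≤ R * Real.exp (R * b) * Λ * ((I.b : ℝ) ^ (-(7 / 4) : ℝ) * (I.d : ℝ) ^ (-(7 / 4) : ℝ)) := by
  have hbp := I.b_cast_pos
  have hdp := I.d_cast_pos
  have hξ1 := I.Icc_subset (hξ I)
  have hleft : I.left ∈ Icc (0 : ℝ) 1 :=
    I.Icc_subset ⟨le_rfl, I.left_le_right⟩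
  have h := (lipschitzFamily_exp (σ₀ := σ₀) (R := R) hb hΛ).lipschitz s hs _ hξ1 _ hleft
  have hΛ0 : 0 ≤ Λ := by
    have := (abs_nonneg _).trans (hΛ 0 (by simp) 1 (by simp))
    simpa using this
  have hR : 0 ≤ R := (norm_nonneg s).trans hs.2.le
  have hdist : |ξ I - I.left| ≤ 1 / (I.b * I.d) := by
    rw [← I.length_eq, FareyInterval.left, abs_of_nonneg (sub_nonneg.mpr (hξ I).1)]
    exact sub_le_sub_right (hξ I).2 _
  have hexp : ‖Complex.exp (-s * I.logSize)‖
      ≤ (I.b : ℝ) ^ (-(3 / 4) : ℝ) * (I.d : ℝ) ^ (-(3 / 4) : ℝ) := by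
    rw [norm_exp_mul_ofReal, Complex.neg_re]
    have := hs.1
    exact I.exp_neg_mul_logSize_le (by norm_num) (by linarith)
  rw [sampledTerm, sampledTerm, ← sub_mul, norm_mul]
  calc _ ≤ (R * Real.exp (R * b) * Λ * (1 / (I.b * I.d)))
        * ((I.b : ℝ) ^ (-(3 / 4) : ℝ) * (I.d : ℝ) ^ (-(3 / 4) : ℝ)) := by
        refine mul_le_mul (h.trans ?_) hexp (norm_nonneg _) (by positivity)
        gcongr
    _ = _ := by
      have e : ∀ x : ℝ, 0 < x → x ^ (-(7 / 4) : ℝ) = x⁻¹ * x ^ (-(3 / 4) : ℝ) := by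
        intro x hx
        rw [← Real.rpow_neg_one x, ← Real.rpow_add hx]
        norm_num
      rw [e _ hbp, e _ hdp]
      field_simp

/-- The sum of the changes of the terms when every sample point is moved to the left endpoint. -/
def resamplingSeries (l : ℝ → ℝ) (ξ : FareyInterval → ℝ) (s : ℂ) : ℂ :=
  ∑' I : FareyInterval.leftHeavy, (sampledTerm l ξ s I - sampledTerm l FareyInterval.left s I)

/-- The mean value of `exp (s l)`. -/
def expMean (l : ℝ → ℝ) (s : ℂ) : ℂ := ∫ x in (0 : ℝ)..1, Complex.exp (s * l x)

/-- The mean value of the periodized kernel. -/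
def kernelMean (s : ℂ) : ℂ := ∫ x in (0 : ℝ)..1, kernelSum s x

/-- The Dirichlet series of the discrepancies of the unit sums. -/
def discrepancySeries (l : ℝ → ℝ) (s : ℂ) : ℂ :=
  ∑' n : ℕ, ((n + 1 : ℕ) : ℂ) ^ (-3 * s)
    * unitDiscrepancy (fun s x => Complex.exp (s * l x)) kernelSum n s

theorem exists_lipschitzFamily_pair (hb : ∀ x ∈ Icc (0 : ℝ) 1, |l x| ≤ b)
    (hΛ : ∀ x ∈ Icc (0 : ℝ) 1, ∀ y ∈ Icc (0 : ℝ) 1, |l x - l y| ≤ Λ * |x - y|)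
    {σ₀ : ℝ} (hσ₀ : 1 / 2 < σ₀) (R : ℝ) :
    ∃ B L : ℝ, LipschitzFamily (truncatedHalfPlane σ₀ R) (fun s x => Complex.exp (s * l x)) B L
      ∧ LipschitzFamily (truncatedHalfPlane σ₀ R) kernelSum B L :=
  ⟨_, _, (lipschitzFamily_exp hb hΛ).mono (le_max_left _ _) (le_max_left _ _),
    (lipschitzFamily_kernelSum hσ₀).mono (le_max_right _ _) (le_max_right _ _)⟩

theorem exists_mem_truncatedHalfPlane {σ : ℝ} {s : ℂ} (hs : σ < s.re) :
    ∃ σ₀ R : ℝ, σ < σ₀ ∧ s ∈ truncatedHalfPlane σ₀ R := by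
  obtain ⟨σ₀, h1, h2⟩ := exists_between hs
  exact ⟨σ₀, ‖s‖ + 1, h1, h2, by linarith⟩

theorem differentiableAt_expMean (hb : ∀ x ∈ Icc (0 : ℝ) 1, |l x| ≤ b)
    (hΛ : ∀ x ∈ Icc (0 : ℝ) 1, ∀ y ∈ Icc (0 : ℝ) 1, |l x - l y| ≤ Λ * |x - y|) {s : ℂ}
    (hs : 1 / 2 < s.re) : DifferentiableAt ℂ (expMean l) s := by
  obtain ⟨σ₀, R, hσ₀, hsm⟩ := exists_mem_truncatedHalfPlane hs
  have hopen := isOpen_truncatedHalfPlane σ₀ R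
  exact ((lipschitzFamily_exp hb hΛ).differentiableOn_integral hopen).differentiableAt
    (hopen.mem_nhds hsm)

theorem differentiableAt_kernelMean {s : ℂ} (hs : 1 / 2 < s.re) :
    DifferentiableAt ℂ kernelMean s := by
  obtain ⟨σ₀, R, hσ₀, hsm⟩ := exists_mem_truncatedHalfPlane hs
  have hopen := isOpen_truncatedHalfPlane σ₀ R
  exact ((lipschitzFamily_kernelSum hσ₀).differentiableOn_integral hopen).differentiableAt
    (hopen.mem_nhds hsm)

theorem differentiableAt_discrepancySeries (hb : ∀ x ∈ Icc (0 : ℝ) 1, |l x| ≤ b)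
    (hΛ : ∀ x ∈ Icc (0 : ℝ) 1, ∀ y ∈ Icc (0 : ℝ) 1, |l x - l y| ≤ Λ * |x - y|) {s : ℂ}
    (hs : 11 / 18 < s.re) : DifferentiableAt ℂ (discrepancySeries l) s := by
  obtain ⟨σ₀, R, hσ₀, hsm⟩ := exists_mem_truncatedHalfPlane hs
  have hopen := isOpen_truncatedHalfPlane σ₀ R
  obtain ⟨B, L, h1, h2⟩ := exists_lipschitzFamily_pair hb hΛ (by linarith : 1 / 2 < σ₀) R
  exact (h1.differentiableOn_tsum hopen hσ₀ (fun s hs => hs.1.le) h2).differentiableAt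
    (hopen.mem_nhds hsm)

theorem differentiableAt_resamplingSeries (hb : ∀ x ∈ Icc (0 : ℝ) 1, |l x| ≤ b)
    (hΛ : ∀ x ∈ Icc (0 : ℝ) 1, ∀ y ∈ Icc (0 : ℝ) 1, |l x - l y| ≤ Λ * |x - y|)
    (hξ : ∀ I : FareyInterval, ξ I ∈ Icc ((I.c : ℝ) / I.d) ((I.a : ℝ) / I.b)) {s : ℂ}
    (hs : 1 / 2 < s.re) : DifferentiableAt ℂ (resamplingSeries l ξ) s := by
  obtain ⟨σ₀, R, hσ₀, hsm⟩ := exists_mem_truncatedHalfPlane hs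
  have hopen := isOpen_truncatedHalfPlane σ₀ R
  have hsum : Summable fun I : FareyInterval.leftHeavy => R * Real.exp (R * b) * Λ *
      ((I.1.b : ℝ) ^ (-(7 / 4) : ℝ) * (I.1.d : ℝ) ^ (-(7 / 4) : ℝ)) :=
    ((FareyInterval.summable_denominators_rpow (q := 7 / 4) (by norm_num)).mul_left _).subtype _
  refine (Complex.differentiableOn_tsum_of_summable_norm hsum (fun I => ?_) hopen
    fun I s hs => norm_sampledTerm_sub_le hb hΛ hξ hσ₀.le hs I.1).differentiableAt
    (hopen.mem_nhds hsm)
  exact ((differentiable_sampledTerm _).sub (differentiable_sampledTerm _)).differentiableOn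

theorem natCast_succ_cpow_neg_three_mul (n : ℕ) (s : ℂ) :
    ((n + 1 : ℕ) : ℂ) ^ (-3 * s) = Complex.exp (-s * ((3 * Real.log ((n + 1 : ℕ) : ℝ) : ℝ) : ℂ)) := by
  rw [Complex.cpow_def_of_ne_zero (by exact_mod_cast n.succ_ne_zero), Complex.natCast_log.symm]
  congr 1
  push_cast
  ring

theorem sampledTerm_left_ofUnit (l : ℝ → ℝ) (s : ℂ) (n : ℕ) (r : (ZMod (n + 1))ˣ) (k : ℕ) :
    sampledTerm l FareyInterval.left s (FareyInterval.ofUnit n r k)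
      = ((n + 1 : ℕ) : ℂ) ^ (-3 * s) * (Complex.exp (s * l
          ((-((r⁻¹ : (ZMod (n + 1))ˣ) : ZMod (n + 1))).val / ((n + 1 : ℕ) : ℝ)))
        * Complex.exp (-s * logKernel k ((r : ZMod (n + 1)).val / ((n + 1 : ℕ) : ℝ)))) := by
  have hleft : (FareyInterval.ofUnit n r k).left
      = (-((r⁻¹ : (ZMod (n + 1))ˣ) : ZMod (n + 1))).val / ((n + 1 : ℕ) : ℝ) := by
    simp [FareyInterval.left, FareyInterval.ofUnit, FareyInterval.ofDvd]
  rw [sampledTerm, hleft, FareyInterval.logSize_ofUnit, natCast_succ_cpow_neg_three_mul,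
    Complex.ofReal_add, mul_add, Complex.exp_add]
  ring

/-- Absolute convergence allows grouping by `d`, then by the residue `r`; the left endpoint does not
depend on `k`, so the innermost sum is `kernelSum`. -/
theorem tsum_leftHeavy_left (hb : ∀ x ∈ Icc (0 : ℝ) 1, |l x| ≤ b) {s : ℂ} (hs : 2 / 3 < s.re) :
    ∑' I : FareyInterval.leftHeavy, sampledTerm l FareyInterval.left s I
      = ∑' n : ℕ, ((n + 1 : ℕ) : ℂ) ^ (-3 * s)
        * unitSum (n + 1) (fun x => Complex.exp (s * l x)) (kernelSum s) := by
  have hsum : Summable fun I : FareyInterval.leftHeavy =>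
      sampledTerm l FareyInterval.left s I :=
    (summable_sampledTerm hb (fun I => I.Icc_subset ⟨le_rfl, I.left_le_right⟩) hs).subtype _
  set e := Equiv.ofBijective _ FareyInterval.ofUnit_bijective
  have hsum' : Summable fun p : Σ n : ℕ, (ZMod (n + 1))ˣ × ℕ =>
      sampledTerm l FareyInterval.left s (FareyInterval.ofUnit p.1 p.2.1 p.2.2) :=
    e.summable_iff.mpr hsum
  have h1 : ∑' I : FareyInterval.leftHeavy, sampledTerm l FareyInterval.left s I
      = ∑' p : Σ n : ℕ, (ZMod (n + 1))ˣ × ℕ,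
        sampledTerm l FareyInterval.left s (FareyInterval.ofUnit p.1 p.2.1 p.2.2) :=
    (e.tsum_eq fun I : FareyInterval.leftHeavy => sampledTerm l FareyInterval.left s I).symm
  rw [h1, hsum'.tsum_sigma]
  refine tsum_congr fun n => ?_
  rw [(hsum'.sigma_factor n).tsum_prod, tsum_fintype, unitSum, Finset.mul_sum]
  refine Finset.sum_congr rfl fun r _ => ?_
  simp only [sampledTerm_left_ofUnit, tsum_mul_left]
  rfl

theorem tsum_leftHeavy (hb : ∀ x ∈ Icc (0 : ℝ) 1, |l x| ≤ b)
    (hΛ : ∀ x ∈ Icc (0 : ℝ) 1, ∀ y ∈ Icc (0 : ℝ) 1, |l x - l y| ≤ Λ * |x - y|)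
    (hξ : ∀ I : FareyInterval, ξ I ∈ Icc ((I.c : ℝ) / I.d) ((I.a : ℝ) / I.b)) {s : ℂ}
    (hs : 2 / 3 < s.re) :
    ∑' I : FareyInterval.leftHeavy, sampledTerm l ξ s I
      = resamplingSeries l ξ s + discrepancySeries l s
        + riemannZeta (3 * s - 1) / riemannZeta (3 * s) * (expMean l s * kernelMean s) := by
  have hsum1 := (summable_sampledTerm hb (fun I => I.Icc_subset (hξ I)) hs).subtype
    FareyInterval.leftHeavy
  have hsum2 := (summable_sampledTerm (ξ := FareyInterval.left) hb
    (fun I => I.Icc_subset ⟨le_rfl, I.left_le_right⟩) hs).subtype FareyInterval.leftHeavy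
  have h1 : resamplingSeries l ξ s = ∑' I : FareyInterval.leftHeavy, sampledTerm l ξ s I
      - ∑' I : FareyInterval.leftHeavy, sampledTerm l FareyInterval.left s I :=
    hsum1.tsum_sub hsum2
  obtain ⟨σ₀, R, hσ₀, hsm⟩ := exists_mem_truncatedHalfPlane (σ := 11 / 18) (s := s) (by linarith)
  obtain ⟨B, L, hf1, hf2⟩ := exists_lipschitzFamily_pair hb hΛ (by linarith : 1 / 2 < σ₀) R
  have hdisc := hf1.summable_unitDiscrepancy hσ₀ (fun s hs => hs.1.le) hf2 hsm
  have htot := (hasSum_totient_cpow (w := 3 * s) (by simp; linarith)).mul_right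
    (expMean l s * kernelMean s)
  have h2 : ∑' n : ℕ, ((n + 1 : ℕ) : ℂ) ^ (-3 * s)
      * unitSum (n + 1) (fun x => Complex.exp (s * l x)) (kernelSum s)
      = discrepancySeries l s
        + riemannZeta (3 * s - 1) / riemannZeta (3 * s) * (expMean l s * kernelMean s) := by
    rw [discrepancySeries, ← htot.tsum_eq, ← hdisc.tsum_add htot.summable]
    refine tsum_congr fun n => ?_
    rw [unitDiscrepancy, expMean, kernelMean, neg_mul]
    ring
  rw [tsum_leftHeavy_left hb hs] at h1
  rw [add_assoc, ← h2, h1, sub_add_cancel]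

end FareySeries


/-! ### Joining both halves; the polar part. -/

section FullSeries

variable {l : ℝ → ℝ} {b Λ : ℝ} {ξ : FareyInterval → ℝ}

/-- The sample points of the reflected intervals. -/
def reflectSamples (ξ : FareyInterval → ℝ) (I : FareyInterval) : ℝ := 1 - ξ I.reflect

theorem reflectSamples_mem
    (hξ : ∀ I : FareyInterval, ξ I ∈ Icc ((I.c : ℝ) / I.d) ((I.a : ℝ) / I.b))
    (I : FareyInterval) : reflectSamples ξ I ∈ Icc ((I.c : ℝ) / I.d) ((I.a : ℝ) / I.b) := by
  have h := hξ I.reflect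
  have hb := I.b_cast_pos
  have hd := I.d_cast_pos
  have e1 : (I.reflect.c : ℝ) / I.reflect.d = 1 - I.a / I.b := by
    change (((I.b : ℤ) - I.a : ℤ) : ℝ) / I.b = _
    push_cast
    field_simp
  have e2 : (I.reflect.a : ℝ) / I.reflect.b = 1 - I.c / I.d := by
    change (((I.d : ℤ) - I.c : ℤ) : ℝ) / I.d = _
    push_cast
    field_simp
  rw [e1, e2] at h
  constructor
  · rw [reflectSamples]; linarith [h.2]
  · rw [reflectSamples]; linarith [h.1]

theorem one_sub_mem_Icc {x : ℝ} (hx : x ∈ Icc (0 : ℝ) 1) : 1 - x ∈ Icc (0 : ℝ) 1 :=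
  ⟨by linarith [hx.2], by linarith [hx.1]⟩

theorem abs_comp_one_sub_le (hb : ∀ x ∈ Icc (0 : ℝ) 1, |l x| ≤ b) :
    ∀ x ∈ Icc (0 : ℝ) 1, |l (1 - x)| ≤ b := fun _ hx => hb _ (one_sub_mem_Icc hx)

theorem abs_comp_one_sub_sub_le
    (hΛ : ∀ x ∈ Icc (0 : ℝ) 1, ∀ y ∈ Icc (0 : ℝ) 1, |l x - l y| ≤ Λ * |x - y|) :
    ∀ x ∈ Icc (0 : ℝ) 1, ∀ y ∈ Icc (0 : ℝ) 1, |l (1 - x) - l (1 - y)| ≤ Λ * |x - y| := by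
  intro x hx y hy
  have h := hΛ _ (one_sub_mem_Icc hx) _ (one_sub_mem_Icc hy)
  rwa [show 1 - x - (1 - y) = y - x by ring, abs_sub_comm y x] at h

theorem sampledTerm_reflect (s : ℂ) (I : FareyInterval) :
    sampledTerm (fun x => l (1 - x)) (reflectSamples ξ) s I = sampledTerm l ξ s I.reflect := by
  simp only [sampledTerm, reflectSamples, sub_sub_cancel, FareyInterval.logSize_reflect]

theorem expMean_comp_one_sub (s : ℂ) : expMean (fun x => l (1 - x)) s = expMean l s := by
  have := intervalIntegral.integral_comp_sub_left (a := 0) (b := 1)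
    (fun x => Complex.exp (s * l x)) 1
  simpa [expMean] using this

/-- The part of the Farey series that stays holomorphic at `2 / 3`. -/
def regularPart (l : ℝ → ℝ) (ξ : FareyInterval → ℝ) (s : ℂ) : ℂ :=
  resamplingSeries l ξ s + discrepancySeries l s
    + (resamplingSeries (fun x => l (1 - x)) (reflectSamples ξ) s
      + discrepancySeries (fun x => l (1 - x)) s)
    - sampledTerm l ξ s FareyInterval.unitInterval

/-- The part of the Farey series that carries the pole at `2 / 3`. -/
def polarPart (l : ℝ → ℝ) (s : ℂ) : ℂ :=
  riemannZeta (3 * s - 1) / riemannZeta (3 * s) * (2 * (expMean l s * kernelMean s))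

theorem differentiableAt_regularPart (hb : ∀ x ∈ Icc (0 : ℝ) 1, |l x| ≤ b)
    (hΛ : ∀ x ∈ Icc (0 : ℝ) 1, ∀ y ∈ Icc (0 : ℝ) 1, |l x - l y| ≤ Λ * |x - y|)
    (hξ : ∀ I : FareyInterval, ξ I ∈ Icc ((I.c : ℝ) / I.d) ((I.a : ℝ) / I.b)) {s : ℂ}
    (hs : 11 / 18 < s.re) : DifferentiableAt ℂ (regularPart l ξ) s := by
  have hs' : 1 / 2 < s.re := by linarith
  have hb' := abs_comp_one_sub_le hb
  have hΛ' := abs_comp_one_sub_sub_le hΛ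
  exact (((differentiableAt_resamplingSeries hb hΛ hξ hs').add
    (differentiableAt_discrepancySeries hb hΛ hs)).add
    ((differentiableAt_resamplingSeries hb' hΛ' (reflectSamples_mem hξ) hs').add
    (differentiableAt_discrepancySeries hb' hΛ' hs))).sub
    (differentiable_sampledTerm _ s)

theorem differentiableAt_polarPart (hb : ∀ x ∈ Icc (0 : ℝ) 1, |l x| ≤ b)
    (hΛ : ∀ x ∈ Icc (0 : ℝ) 1, ∀ y ∈ Icc (0 : ℝ) 1, |l x - l y| ≤ Λ * |x - y|) {s : ℂ}
    (hs : 11 / 18 < s.re) (hs' : s ≠ 2 / 3) : DifferentiableAt ℂ (polarPart l) s := by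
  have h1 : 3 * s - 1 ≠ 1 := fun h => hs' (by linear_combination h / 3)
  have h2 : 3 * s ≠ 1 := fun h => by
    have := congrArg Complex.re h
    simp at this
    linarith
  have h3 : riemannZeta (3 * s) ≠ 0 :=
    riemannZeta_ne_zero_of_one_le_re (by simp; linarith)
  have d1 : DifferentiableAt ℂ (fun s : ℂ => riemannZeta (3 * s - 1)) s :=
    (differentiableAt_riemannZeta h1).comp s (by fun_prop)
  have d2 : DifferentiableAt ℂ (fun s : ℂ => riemannZeta (3 * s)) s :=
    (differentiableAt_riemannZeta h2).comp s (by fun_prop)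
  exact (d1.div d2 h3).mul (((differentiableAt_expMean hb hΛ (by linarith)).mul
    (differentiableAt_kernelMean (by linarith))).const_mul 2)

theorem tsum_sampledTerm (hb : ∀ x ∈ Icc (0 : ℝ) 1, |l x| ≤ b)
    (hΛ : ∀ x ∈ Icc (0 : ℝ) 1, ∀ y ∈ Icc (0 : ℝ) 1, |l x - l y| ≤ Λ * |x - y|)
    (hξ : ∀ I : FareyInterval, ξ I ∈ Icc ((I.c : ℝ) / I.d) ((I.a : ℝ) / I.b)) {s : ℂ}
    (hs : 2 / 3 < s.re) :
    ∑' I : FareyInterval, sampledTerm l ξ s I = regularPart l ξ s + polarPart l s := by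
  have hsum := summable_sampledTerm hb (fun I => I.Icc_subset (hξ I)) hs
  have h1 := tsum_leftHeavy hb hΛ hξ hs
  have h2 := tsum_leftHeavy (abs_comp_one_sub_le hb) (abs_comp_one_sub_sub_le hΛ)
    (reflectSamples_mem hξ) hs
  rw [expMean_comp_one_sub] at h2
  have h3 : ∑' I : FareyInterval.leftHeavy,
      sampledTerm (fun x => l (1 - x)) (reflectSamples ξ) s I
      = ∑' I : {I : FareyInterval | I.b ≤ I.d}, sampledTerm l ξ s I := by
    rw [← FareyInterval.reflectEquiv.tsum_eq]
    exact tsum_congr fun I => sampledTerm_reflect s I.1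
  rw [h3] at h2
  -- Inclusion and exclusion: `b = d` happens only for `[0, 1]`, which both halves contain.
  have h4 : ∀ I : FareyInterval, sampledTerm l ξ s I
      = FareyInterval.leftHeavy.indicator (sampledTerm l ξ s) I
        + {I : FareyInterval | I.b ≤ I.d}.indicator (sampledTerm l ξ s) I
        - ({FareyInterval.unitInterval} : Set FareyInterval).indicator (sampledTerm l ξ s) I := by
    classical
    intro I
    have hu : I ∈ ({FareyInterval.unitInterval} : Set FareyInterval) ↔ I.b = I.d :=
      ⟨fun h => by rw [mem_singleton_iff.mp h]; rfl, I.eq_unitInterval⟩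
    have hl : I ∈ FareyInterval.leftHeavy ↔ I.d ≤ I.b := Iff.rfl
    have hr : I ∈ {I : FareyInterval | I.b ≤ I.d} ↔ I.b ≤ I.d := Iff.rfl
    simp only [indicator_apply, hu, hl, hr]
    rcases lt_trichotomy I.b I.d with h | h | h
    · simp [h.not_ge, h.le, h.ne]
    · simp [h]
    · simp [h.not_ge, h.le, h.ne']
  rw [tsum_congr h4, ((hsum.indicator _).add (hsum.indicator _)).tsum_sub (hsum.indicator _),
    (hsum.indicator _).tsum_add (hsum.indicator _), ← tsum_subtype, ← tsum_subtype,
    ← tsum_subtype, tsum_singleton, h1, h2, regularPart, polarPart]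
  ring

/-- With `w = 3s - 1` one has `s - 2/3 = (w - 1)/3`, so the residue `1` of zeta at `1` becomes
`1/3`. -/
theorem tendsto_mul_polarPart (hb : ∀ x ∈ Icc (0 : ℝ) 1, |l x| ≤ b)
    (hΛ : ∀ x ∈ Icc (0 : ℝ) 1, ∀ y ∈ Icc (0 : ℝ) 1, |l x - l y| ≤ Λ * |x - y|) :
    Tendsto (fun s : ℂ => (s - 2 / 3) * polarPart l s) (𝓝[≠] (2 / 3))
      (𝓝 (1 / 3 / riemannZeta 2 * (2 * (expMean l (2 / 3) * kernelMean (2 / 3))))) := by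
  have hre : ((2 / 3 : ℂ)).re = 2 / 3 := by norm_num
  have hmap : Tendsto (fun s : ℂ => 3 * s - 1) (𝓝[≠] (2 / 3)) (𝓝[≠] 1) := by
    refine tendsto_nhdsWithin_iff.mpr ⟨?_, ?_⟩
    · have : Continuous fun s : ℂ => 3 * s - 1 := by fun_prop
      have h := this.tendsto (2 / 3)
      rw [show (3 : ℂ) * (2 / 3) - 1 = 1 by norm_num] at h
      exact h.mono_left nhdsWithin_le_nhds
    · filter_upwards [self_mem_nhdsWithin] with s hs h
      exact hs (by
        have h' : 3 * s - 1 = 1 := h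
        change s = 2 / 3
        linear_combination h' / 3)
  have h1 : Tendsto (fun s : ℂ => (s - 2 / 3) * riemannZeta (3 * s - 1)) (𝓝[≠] (2 / 3))
      (𝓝 (1 / 3)) := by
    have := (riemannZeta_residue_one.comp hmap).const_mul (1 / 3 : ℂ)
    rw [mul_one] at this
    refine this.congr fun s => ?_
    simp only [Function.comp_apply]
    ring
  have h2 : Tendsto (fun s : ℂ => riemannZeta (3 * s)) (𝓝[≠] (2 / 3)) (𝓝 (riemannZeta 2)) := by
    have hd : ContinuousAt (fun s : ℂ => riemannZeta (3 * s)) (2 / 3) := by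
      refine ContinuousAt.comp (g := riemannZeta) (f := fun s : ℂ => 3 * s) ?_ (by fun_prop)
      exact (differentiableAt_riemannZeta (by norm_num)).continuousAt
    have := hd.tendsto
    rw [show (3 : ℂ) * (2 / 3) = 2 by norm_num] at this
    exact this.mono_left nhdsWithin_le_nhds
  have h3 : Tendsto (fun s : ℂ => 2 * (expMean l s * kernelMean s)) (𝓝[≠] (2 / 3))
      (𝓝 (2 * (expMean l (2 / 3) * kernelMean (2 / 3)))) := by
    have hA := differentiableAt_expMean hb hΛ (s := 2 / 3) (by rw [hre]; norm_num)
    have hK := differentiableAt_kernelMean (s := 2 / 3) (by rw [hre]; norm_num)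
    exact ((hA.mul hK).const_mul 2).continuousAt.tendsto.mono_left nhdsWithin_le_nhds
  have hζ : riemannZeta 2 ≠ 0 := riemannZeta_ne_zero_of_one_le_re (by norm_num)
  refine ((h1.div h2 hζ).mul h3).congr fun s => ?_
  simp only [Pi.div_apply, polarPart]
  ring

end FullSeries

/-! ### Recognizing a simple pole. -/

section Poles

/-- A function with a nonzero finite limit of `(s - a) g(s)` has a simple pole at `a`. -/
theorem meromorphicAt_and_order_of_tendsto {g : ℂ → ℂ} {a ρ : ℂ}
    (hg : ∀ᶠ s in 𝓝[≠] a, DifferentiableAt ℂ g s)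
    (hlim : Tendsto (fun s => (s - a) * g s) (𝓝[≠] a) (𝓝 ρ)) (hρ : ρ ≠ 0) :
    MeromorphicAt g a ∧ meromorphicOrderAt g a = -1 := by
  -- Filling in the limit removes the singularity, so `u` is analytic with `u a ≠ 0` and `g = u/(s -
  -- a)`.
  set u : ℂ → ℂ := Function.update (fun s => (s - a) * g s) a ρ with hu
  have hueq : ∀ s, s ≠ a → u s = (s - a) * g s := fun s hs => Function.update_of_ne hs _ _
  have hua : u a = ρ := Function.update_self _ _ _
  have hcont : ContinuousAt u a := continuousAt_update_same.mpr hlim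
  have hdiff : ∀ᶠ s in 𝓝[≠] a, DifferentiableAt ℂ u s := by
    filter_upwards [hg, self_mem_nhdsWithin] with s hs hsa
    have : u =ᶠ[𝓝 s] fun s => (s - a) * g s := by
      filter_upwards [isOpen_ne.mem_nhds hsa] with t ht using hueq t ht
    exact ((by fun_prop : DifferentiableAt ℂ (fun s => s - a) s).mul hs).congr_of_eventuallyEq this
  have han : AnalyticAt ℂ u a :=
    Complex.analyticAt_of_differentiable_on_punctured_nhds_of_continuousAt hdiff hcont
  have hgu : g =ᶠ[𝓝[≠] a] fun s => (s - a) ^ (-1 : ℤ) • u s := by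
    filter_upwards [self_mem_nhdsWithin] with s hs
    have hs' : s - a ≠ 0 := sub_ne_zero.mpr hs
    rw [hueq s hs, smul_eq_mul, zpow_neg_one, inv_mul_cancel_left₀ hs']
  have hmer : MeromorphicAt g a := by
    refine MeromorphicAt.congr ?_ hgu.symm
    exact (((MeromorphicAt.id a).sub (MeromorphicAt.const a a)).zpow (-1)).smul han.meromorphicAt
  refine ⟨hmer, ?_⟩
  have := (meromorphicOrderAt_eq_int_iff (n := -1) hmer).mpr ⟨u, han, hua ▸ hρ, hgu⟩
  simpa using this

end Poles

/-! ### Hata coefficients and the curvature `f''`. -/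

section HataCoefficients

variable {f : ℝ → ℝ}

theorem hasDerivAt_of_mem_Ioo (hf : ContDiffOn ℝ 3 f (Icc (0 : ℝ) 1)) {x : ℝ}
    (hx : x ∈ Ioo (0 : ℝ) 1) : HasDerivAt f (derivWithin f (Icc 0 1) x) x :=
  ((hf.differentiableOn (by norm_num) x (Ioo_subset_Icc_self hx)).hasDerivWithinAt).hasDerivAt
    (Icc_mem_nhds hx.1 hx.2)

theorem secondDeriv_eq (x : ℝ) :
    secondDeriv f x = derivWithin (derivWithin f (Icc 0 1)) (Icc 0 1) x := by
  rw [secondDeriv, show (2 : ℕ) = 1 + 1 by rfl, iteratedDerivWithin_succ, iteratedDerivWithin_one]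

theorem contDiffOn_derivWithin (hf : ContDiffOn ℝ 3 f (Icc (0 : ℝ) 1)) :
    ContDiffOn ℝ 2 (derivWithin f (Icc 0 1)) (Icc 0 1) :=
  hf.derivWithin (uniqueDiffOn_Icc zero_lt_one) (by norm_num)

theorem contDiffOn_secondDeriv (hf : ContDiffOn ℝ 3 f (Icc (0 : ℝ) 1)) :
    ContDiffOn ℝ 1 (secondDeriv f) (Icc 0 1) := by
  rw [funext (secondDeriv_eq (f := f))]
  exact (contDiffOn_derivWithin hf).derivWithin (uniqueDiffOn_Icc zero_lt_one) (by norm_num)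

theorem hasDerivAt_derivWithin_of_mem_Ioo (hf : ContDiffOn ℝ 3 f (Icc (0 : ℝ) 1)) {x : ℝ}
    (hx : x ∈ Ioo (0 : ℝ) 1) :
    HasDerivAt (derivWithin f (Icc 0 1)) (secondDeriv f x) x := by
  rw [secondDeriv_eq]
  exact (((contDiffOn_derivWithin hf).differentiableOn (by norm_num) x
    (Ioo_subset_Icc_self hx)).hasDerivWithinAt).hasDerivAt (Icc_mem_nhds hx.1 hx.2)

/-- The mean value form of the renormalized Hata coefficient. -/
theorem exists_hataT_eq (hf : ContDiffOn ℝ 3 f (Icc (0 : ℝ) 1)) (I : FareyInterval) :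
    ∃ x ∈ Icc ((I.c : ℝ) / I.d) ((I.a : ℝ) / I.b),
      hataT f I = -(secondDeriv f x / (2 * (I.b * I.d * (I.b + I.d)))) := by
  have hb := I.b_cast_pos
  have hd := I.d_cast_pos
  have hdet : (I.a : ℝ) * I.d - I.b * I.c = 1 := by exact_mod_cast I.det_eq
  set u : ℝ := (I.c : ℝ) / I.d with hu
  set w : ℝ := (I.a : ℝ) / I.b with hw
  set v : ℝ := ((I.a : ℝ) + I.c) / (I.b + I.d) with hv
  have huv : v - u = 1 / (I.d * (I.b + I.d)) := by
    rw [hv, hu]; field_simp; linarith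
  have hvw : w - v = 1 / (I.b * (I.b + I.d)) := by
    rw [hv, hw]; field_simp; linarith
  have huv0 : u < v := by
    have : 0 < 1 / ((I.d : ℝ) * (I.b + I.d)) := by positivity
    linarith
  have hvw0 : v < w := by
    have : 0 < 1 / ((I.b : ℝ) * (I.b + I.d)) := by positivity
    linarith
  have hu0 : 0 ≤ u := I.left_nonneg
  have hw1 : w ≤ 1 := I.right_le_one
  -- `K` is chosen so that the weighted difference of `q = f - Kx²` vanishes. Then `q` has equal
  -- slopes on the two halves, and Rolle's theorem for `q'` gives a point where `f'' = 2K`.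
  set K : ℝ := -(I.b * I.d * (I.b + I.d) * hataT f I) with hK
  set q : ℝ → ℝ := fun x => f x - K * x ^ 2 with hq
  set q' : ℝ → ℝ := fun x => derivWithin f (Icc 0 1) x - K * (2 * x) with hq'
  have hTf : hataT f I = (I.b + I.d) * f v - I.b * f w - I.d * f u := by
    rw [hataT, hataCoeff, ← hv, ← hw, ← hu]
    field_simp
  have hqT : (I.b + I.d) * q v - I.b * q w - I.d * q u = 0 := by
    have hsq : ((I.b : ℝ) + I.d) * v ^ 2 - I.b * w ^ 2 - I.d * u ^ 2
        = -(1 / (I.b * I.d * (I.b + I.d))) := by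
      have e1 : w = v + 1 / (I.b * (I.b + I.d)) := by linarith
      have e2 : u = v - 1 / (I.d * (I.b + I.d)) := by linarith
      rw [e1, e2]
      field_simp
      ring
    have : (I.b + I.d) * q v - I.b * q w - I.d * q u
        = hataT f I - K * (((I.b : ℝ) + I.d) * v ^ 2 - I.b * w ^ 2 - I.d * u ^ 2) := by
      rw [hTf, hq]; ring
    rw [this, hsq, hK]
    field_simp
    ring
  have hqd : ∀ x ∈ Ioo (0 : ℝ) 1, HasDerivAt q (q' x) x := by
    intro x hx
    have := (hasDerivAt_of_mem_Ioo hf hx).sub (((hasDerivAt_pow 2 x)).const_mul K)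
    convert! this using 1
    simp [hq']
  have hqc : ContinuousOn q (Icc 0 1) := hf.continuousOn.sub (by fun_prop)
  have hq'd : ∀ x ∈ Ioo (0 : ℝ) 1, HasDerivAt q' (secondDeriv f x - 2 * K) x := by
    intro x hx
    have := (hasDerivAt_derivWithin_of_mem_Ioo hf hx).sub
      (((hasDerivAt_id x).const_mul 2).const_mul K)
    convert! this using 1
    ring
  obtain ⟨x₁, hx₁, h1⟩ := exists_hasDerivAt_eq_slope q q' huv0
    (hqc.mono (Icc_subset_Icc hu0 (hvw0.le.trans hw1)))
    (fun x hx => hqd x ⟨hu0.trans_lt hx.1, hx.2.trans_le (hvw0.le.trans hw1)⟩)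
  obtain ⟨x₂, hx₂, h2⟩ := exists_hasDerivAt_eq_slope q q' hvw0
    (hqc.mono (Icc_subset_Icc (hu0.trans huv0.le) hw1))
    (fun x hx => hqd x ⟨(hu0.trans huv0.le).trans_lt hx.1, hx.2.trans_le hw1⟩)
  have hslope : q' x₁ = q' x₂ := by
    rw [h1, h2, huv, hvw]
    field_simp
    linear_combination hqT
  have hx12 : x₁ < x₂ := hx₁.2.trans hx₂.1
  have hsub : ∀ x ∈ Icc x₁ x₂, x ∈ Ioo (0 : ℝ) 1 := fun x hx =>
    ⟨hu0.trans_lt (hx₁.1.trans_le hx.1), (hx.2.trans_lt hx₂.2).trans_le hw1⟩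
  obtain ⟨x, hx, h3⟩ := exists_hasDerivAt_eq_zero hx12
    (fun x hx => (hq'd x (hsub x hx)).continuousAt.continuousWithinAt) hslope
    (fun x hx => hq'd x (hsub x (Ioo_subset_Icc_self hx)))
  refine ⟨x, ⟨hx₁.1.le.trans hx.1.le, hx.2.le.trans hx₂.2.le⟩, ?_⟩
  have h4 : secondDeriv f x = 2 * K := by linarith
  rw [h4, hK]
  field_simp

theorem exists_secondDeriv_lipschitz (hf : ContDiffOn ℝ 3 f (Icc (0 : ℝ) 1)) :
    ∃ L : ℝ, ∀ x ∈ Icc (0 : ℝ) 1, ∀ y ∈ Icc (0 : ℝ) 1,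
      |secondDeriv f x - secondDeriv f y| ≤ L * |x - y| := by
  have h := contDiffOn_secondDeriv hf
  have hc : ContinuousOn (derivWithin (secondDeriv f) (Icc 0 1)) (Icc 0 1) :=
    h.continuousOn_derivWithin (uniqueDiffOn_Icc zero_lt_one) le_rfl
  obtain ⟨L, hL⟩ := isCompact_Icc.exists_bound_of_continuousOn hc
  exact ⟨L, fun x hx y hy => (convex_Icc (0 : ℝ) 1).norm_image_sub_le_of_norm_derivWithin_le
    (h.differentiableOn (by norm_num)) hL hy hx⟩

/-- The logarithm of `|f''| / 2`. -/
def logCurvature (f : ℝ → ℝ) (x : ℝ) : ℝ := Real.log (|secondDeriv f x| / 2)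

variable {m : ℝ}

/-- Dividing by `m` brings the arguments into `[1, ∞)`, where the logarithm is 1-Lipschitz; `f''`
itself is Lipschitz since `f` is `C³`. -/
theorem exists_logCurvature_lipschitz (hf : ContDiffOn ℝ 3 f (Icc (0 : ℝ) 1)) (hm : 0 < m)
    (hf2 : ∀ x ∈ Icc (0 : ℝ) 1, m ≤ |secondDeriv f x|) :
    ∃ Λ : ℝ, ∀ x ∈ Icc (0 : ℝ) 1, ∀ y ∈ Icc (0 : ℝ) 1,
      |logCurvature f x - logCurvature f y| ≤ Λ * |x - y| := by
  obtain ⟨L, hL⟩ := exists_secondDeriv_lipschitz hf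
  refine ⟨L / m, fun x hx y hy => ?_⟩
  have hx' := hf2 x hx
  have hy' := hf2 y hy
  have hx0 : 0 < |secondDeriv f x| := hm.trans_le hx'
  have hy0 : 0 < |secondDeriv f y| := hm.trans_le hy'
  have e : logCurvature f x - logCurvature f y
      = Real.log (|secondDeriv f x| / m) - Real.log (|secondDeriv f y| / m) := by
    rw [logCurvature, logCurvature, Real.log_div hx0.ne' two_ne_zero,
      Real.log_div hy0.ne' two_ne_zero, Real.log_div hx0.ne' hm.ne', Real.log_div hy0.ne' hm.ne']
    ring
  rw [e]
  refine (abs_log_sub_log_le ((one_le_div hm).mpr hx') ((one_le_div hm).mpr hy')).trans ?_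
  rw [← sub_div, abs_div, abs_of_pos hm, div_mul_eq_mul_div]
  gcongr
  exact (abs_abs_sub_abs_le _ _).trans (hL x hx y hy)

theorem abs_le_of_lipschitz {l : ℝ → ℝ} {Λ : ℝ}
    (hΛ : ∀ x ∈ Icc (0 : ℝ) 1, ∀ y ∈ Icc (0 : ℝ) 1, |l x - l y| ≤ Λ * |x - y|) :
    ∀ x ∈ Icc (0 : ℝ) 1, |l x| ≤ |l 0| + Λ := by
  intro x hx
  have hΛ0 : 0 ≤ Λ := by
    have := (abs_nonneg _).trans (hΛ 0 (by simp) 1 (by simp))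
    simpa using this
  have h1 := hΛ x hx 0 (by simp)
  rw [sub_zero, abs_of_nonneg hx.1] at h1
  have h2 : |l x| ≤ |l x - l 0| + |l 0| := by
    have := abs_add_le (l x - l 0) (l 0)
    rwa [sub_add_cancel] at this
  nlinarith [hx.2]

theorem fareyTerm_eq_sampledTerm (hm : 0 < m)
    (hf2 : ∀ x ∈ Icc (0 : ℝ) 1, m ≤ |secondDeriv f x|) {ξ : FareyInterval → ℝ}
    (hξ : ∀ I : FareyInterval, ξ I ∈ Icc ((I.c : ℝ) / I.d) ((I.a : ℝ) / I.b))
    (hT : ∀ I : FareyInterval,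
      hataT f I = -(secondDeriv f (ξ I) / (2 * (I.b * I.d * (I.b + I.d))))) (s : ℂ) :
    fareyTerm f s = sampledTerm (logCurvature f) ξ s := by
  funext I
  have hb := I.b_cast_pos
  have hd := I.d_cast_pos
  have hF : 0 < |secondDeriv f (ξ I)| := hm.trans_le (hf2 _ (I.Icc_subset (hξ I)))
  have hN : (0 : ℝ) < I.b * I.d * (I.b + I.d) := by positivity
  have habs : |hataT f I| = |secondDeriv f (ξ I)| / 2 / (I.b * I.d * (I.b + I.d)) := by
    rw [hT I, abs_neg, abs_div, abs_of_pos (by positivity : (0 : ℝ) < 2 * _), div_div]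
  have hlog : Real.log |hataT f I| = logCurvature f (ξ I) - I.logSize := by
    rw [habs, Real.log_div (by positivity) hN.ne', logCurvature, FareyInterval.logSize]
  have hpos : 0 < |hataT f I| := by rw [habs]; positivity
  rw [fareyTerm, sampledTerm, Complex.cpow_def_of_ne_zero (by exact_mod_cast hpos.ne'),
    ← Complex.ofReal_log hpos.le, hlog, ← Complex.exp_add]
  congr 1
  push_cast
  ring

theorem expMean_logCurvature (hm : 0 < m)
    (hf2 : ∀ x ∈ Icc (0 : ℝ) 1, m ≤ |secondDeriv f x|) :
    expMean (logCurvature f) (2 / 3)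
      = ((1 / 2 ^ (2 / 3 : ℝ) * ∫ v in (0 : ℝ)..1, |secondDeriv f v| ^ (2 / 3 : ℝ) : ℝ) : ℂ) := by
  rw [← intervalIntegral.integral_const_mul, ← intervalIntegral.integral_ofReal, expMean]
  refine intervalIntegral.integral_congr fun x hx => ?_
  rw [uIcc_of_le zero_le_one] at hx
  have hF : 0 < |secondDeriv f x| := hm.trans_le (hf2 x hx)
  have h : 1 / 2 ^ (2 / 3 : ℝ) * |secondDeriv f x| ^ (2 / 3 : ℝ)
      = (|secondDeriv f x| / 2) ^ (2 / 3 : ℝ) := by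
    rw [Real.div_rpow hF.le zero_le_two]; ring
  rw [h, Real.rpow_def_of_pos (by positivity), logCurvature]
  push_cast
  congr 1
  ring

theorem integral_secondDeriv_rpow_pos (hf : ContDiffOn ℝ 3 f (Icc (0 : ℝ) 1)) (hm : 0 < m)
    (hf2 : ∀ x ∈ Icc (0 : ℝ) 1, m ≤ |secondDeriv f x|) :
    0 < ∫ v in (0 : ℝ)..1, |secondDeriv f v| ^ (2 / 3 : ℝ) := by
  refine intervalIntegral.intervalIntegral_pos_of_pos_on ?_ (fun x hx => ?_) zero_lt_one
  · refine ContinuousOn.intervalIntegrable ?_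
    rw [uIcc_of_le zero_le_one]
    exact (contDiffOn_secondDeriv hf).continuousOn.abs.rpow_const fun x _ => Or.inr (by norm_num)
  · exact Real.rpow_pos_of_pos (hm.trans_le (hf2 x (Ioo_subset_Icc_self hx))) _

end HataCoefficients

end

/-! ### Assembly of the continuation and the residue. -/

theorem theorem3 (f : ℝ → ℝ) (hf : ContDiffOn ℝ 3 f (Icc (0 : ℝ) 1))
    (m : ℝ) (hm : 0 < m) (hf2 : ∀ x ∈ Icc (0 : ℝ) 1, m ≤ |secondDeriv f x|) :
    (∀ s : ℂ, 2 / 3 < s.re → Summable (fareyTerm f s)) ∧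
    ∀ η : ℝ, 0 < η → η < 1 / 21 →
      ∃ g : ℂ → ℂ,
        -- `g` extends `Z_f` from the half-plane of absolute convergence
        (∀ s : ℂ, 2 / 3 < s.re → g s = fareyZeta f s) ∧
        -- meromorphically to the disk, without other singularities than `2/3`
        MeromorphicOn g ({s : ℂ | 2 / 3 < s.re} ∪ Metric.ball (2 / 3 : ℂ) η) ∧
        AnalyticOnNhd ℂ g
          (({s : ℂ | 2 / 3 < s.re} ∪ Metric.ball (2 / 3 : ℂ) η) \ {(2 / 3 : ℂ)}) ∧
        -- with a simple pole at `2/3`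
        meromorphicOrderAt g (2 / 3 : ℂ) = -1 ∧
        -- and the stated residue, `lim (s - 2/3) g(s)`
        Tendsto (fun s : ℂ => (s - 2 / 3) * g s) (𝓝[≠] (2 / 3 : ℂ))
          (𝓝 ((Real.sqrt 3 * Real.Gamma (1 / 3) ^ 3 / ((2 : ℝ) ^ (2 / 3 : ℝ) * Real.pi ^ 3)
            * ∫ v in (0 : ℝ)..1, |secondDeriv f v| ^ (2 / 3 : ℝ) : ℝ) : ℂ)) := by
  choose ξ hξ hT using exists_hataT_eq hf
  obtain ⟨Λ, hΛ⟩ := exists_logCurvature_lipschitz hf hm hf2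
  have hb := abs_le_of_lipschitz hΛ
  have hterm := fareyTerm_eq_sampledTerm hm hf2 hξ hT
  refine ⟨fun s hs => hterm s ▸ summable_sampledTerm hb (fun I => I.Icc_subset (hξ I)) hs,
    fun η hη hη' => ?_⟩
  set g : ℂ → ℂ := fun s => regularPart (logCurvature f) ξ s + polarPart (logCurvature f) s
  have hre : ((2 / 3 : ℂ)).re = 2 / 3 := by norm_num
  -- The disk fits because `2/3 - 1/21 = 13/21 > 11/18`.
  have hdom : ∀ s ∈ {s : ℂ | 2 / 3 < s.re} ∪ Metric.ball (2 / 3 : ℂ) η, 11 / 18 < s.re := by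
    rintro s (hs | hs)
    · have : 2 / 3 < s.re := hs
      linarith
    · have h1 := (Complex.abs_re_le_norm (s - 2 / 3)).trans_lt (mem_ball_iff_norm.mp hs)
      rw [Complex.sub_re, hre] at h1
      linarith [(abs_lt.mp h1).1]
  have hdiff : ∀ s : ℂ, 11 / 18 < s.re → s ≠ 2 / 3 → DifferentiableAt ℂ g s := fun s hs hs' =>
    (differentiableAt_regularPart hb hΛ hξ hs).add (differentiableAt_polarPart hb hΛ hs hs')
  have hopen : IsOpen {s : ℂ | 11 / 18 < s.re} := isOpen_lt continuous_const Complex.continuous_re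
  have hmem : (2 / 3 : ℂ) ∈ {s : ℂ | 11 / 18 < s.re} := by
    change 11 / 18 < ((2 / 3 : ℂ)).re
    rw [hre]; norm_num
  have han : ∀ s : ℂ, 11 / 18 < s.re → s ≠ 2 / 3 → AnalyticAt ℂ g s := by
    intro s hs hs'
    have hopen' : IsOpen ({s : ℂ | 11 / 18 < s.re} \ {2 / 3}) := hopen.sdiff isClosed_singleton
    exact DifferentiableOn.analyticAt (s := {s : ℂ | 11 / 18 < s.re} \ {2 / 3})
      (fun t ht => (hdiff t ht.1 ht.2).differentiableWithinAt) (hopen'.mem_nhds ⟨hs, hs'⟩)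
  set ρ : ℝ := Real.sqrt 3 * Real.Gamma (1 / 3) ^ 3 / ((2 : ℝ) ^ (2 / 3 : ℝ) * Real.pi ^ 3)
    * ∫ v in (0 : ℝ)..1, |secondDeriv f v| ^ (2 / 3 : ℝ) with hρ
  have hρ0 : (ρ : ℂ) ≠ 0 := by
    have h1 := integral_secondDeriv_rpow_pos hf hm hf2
    have h2 : 0 < Real.Gamma (1 / 3) := Real.Gamma_pos_of_pos (by norm_num)
    have h3 := Real.pi_pos
    exact_mod_cast (by positivity : 0 < ρ).ne'
  -- With `ζ(2) = π²/6` the constant is `(2/π²) · 2 · 2^(-2/3) · √3 Γ(1/3)³ / (4π)`; the factor `2`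
  -- counts the two halves.
  have hval : 1 / 3 / riemannZeta 2 * (2 * (expMean (logCurvature f) (2 / 3) * kernelMean (2 / 3)))
      = (ρ : ℂ) := by
    rw [expMean_logCurvature hm hf2, kernelMean, integral_kernelSum_two_thirds, riemannZeta_two, hρ]
    have h3 : (Real.pi : ℂ) ≠ 0 := by exact_mod_cast Real.pi_ne_zero
    have h4 : (((2 : ℝ) ^ (2 / 3 : ℝ) : ℝ) : ℂ) ≠ 0 := by
      exact_mod_cast (by positivity : (0 : ℝ) < 2 ^ (2 / 3 : ℝ)).ne'
    push_cast
    field_simp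
    ring
  have hlim : Tendsto (fun s : ℂ => (s - 2 / 3) * g s) (𝓝[≠] (2 / 3 : ℂ)) (𝓝 (ρ : ℂ)) := by
    have h1 := tendsto_mul_polarPart hb hΛ
    rw [hval] at h1
    have h2 : Tendsto (fun s : ℂ => (s - 2 / 3) * regularPart (logCurvature f) ξ s)
        (𝓝[≠] (2 / 3 : ℂ)) (𝓝 0) := by
      have hc : ContinuousAt (fun s : ℂ => (s - 2 / 3) * regularPart (logCurvature f) ξ s)
          (2 / 3) := ContinuousAt.mul (by fun_prop)
        (differentiableAt_regularPart hb hΛ hξ hmem).continuousAt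
      have := hc.tendsto
      rw [sub_self, zero_mul] at this
      exact this.mono_left nhdsWithin_le_nhds
    have := h2.add h1
    rw [zero_add] at this
    exact this.congr fun s => by simp only [g]; ring
  have hev : ∀ᶠ s in 𝓝[≠] (2 / 3 : ℂ), DifferentiableAt ℂ g s := by
    filter_upwards [self_mem_nhdsWithin, mem_nhdsWithin_of_mem_nhds (hopen.mem_nhds hmem)]
      with s hs hs' using hdiff s hs' hs
  obtain ⟨hmer, hord⟩ := meromorphicAt_and_order_of_tendsto hev hlim hρ0
  refine ⟨g, fun s hs => ?_, fun s hs => ?_, fun s hs => han s (hdom s hs.1) hs.2, hord, hlim⟩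
  · rw [fareyZeta, hterm s, tsum_sampledTerm hb hΛ hξ hs]
  · rcases eq_or_ne s (2 / 3) with rfl | hs'
    · exact hmer
    · exact (han s (hdom s hs) hs').meromorphicAt
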